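/- Let $\Bbbk=\mathbb{R}$ or $\mathbb{C}$, and let $\mathbb{S}^n_+(\Bbbk)$ be the cone of positive semidefinite $n\times n$ real symmetric (if $\Bbbk=\mathbb{R}$) or complex Hermitian (if $\Bbbk=\mathbb{C}$) matrices. For $d\in\mathbb{N}$, $d\ge 1$, and $A=(a_{ij})\in\Bbbk^{n\times n}$ put $$\lVert A\rVert_{\gamma,d}^{\Bbbk}=\max\Bigl\{\Bigl|\sum_{i=1}^n\sum_{j=1}^n a_{ij}\langle x_i,x_j\rangle\Bigr| : x_1,\dots,x_n\in\Bbbk^d,\ \lVert x_1\rVert=\dots=\lVert x_n\rVert=1\Bigr\},$$ where $\langle x,y\rangle=x^*y$, and $\lVert A\rVert_\gamma^{\Bbbk}=\lVert A\rVert_{\gamma,n}^{\Bbbk}$. For integers $1\le d\le p$ let $$K_{\mathsf{C},d,p}^{\Bbbk}=\sup_{n\in\mathbb{N}}\ \sup_{0\ne A\in\mathbb{S}^n_+(\Bbbk)}\frac{\lVert A\rVert_{\gamma,p}^{\Bbbk}}{\lVert A\rVert_{\gamma,d}^{\Bbbk}},\qquad K_{\mathsf{C},d,\infty}^{\Bbbk}=\lim_{p\to\infty}K_{\mathsf{C},d,p}^{\Bbbk}.$$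 **Proposition.** For all integers $1\le d\le p$, $$K_{\mathsf{C},d,p}^{\mathbb{R}}\ge\frac{d}{p}\left[\frac{\Gamma\bigl(\frac{p+1}{2}\bigr)\Gamma\bigl(\frac d2\bigr)}{\Gamma\bigl(\frac p2\bigr)\Gamma\bigl(\frac{d+1}{2}\bigr)}\right]^2,\qquad K_{\mathsf{C},d,p}^{\mathbb{C}}\ge\frac{d}{p}\left[\frac{\Gamma\bigl(\frac{2p+1}{2}\bigr)\Gamma(d)}{\Gamma(p)\Gamma\bigl(\frac{2d+1}{2}\bigr)}\right]^2.$$ Furthermore, for every fixed integer $d\ge1$ the limits $K_{\mathsf{C},d,\infty}^{\Bbbk}$ exist and $$K_{\mathsf{C},d,\infty}^{\mathbb{R}}=\frac{d\,\Gamma(d/2)^2}{2\,\Gamma\bigl((d+1)/2\bigr)^2},\qquad K_{\mathsf{C},d,\infty}^{\mathbb{C}}=\frac{d\,\Gamma(d)^2}{\Gamma\bigl((2d+1)/2\bigr)^2}.$$ Consequently, for all integers $d\ge1$, $n\ge 1$ and all $A\in\mathbb{S}^n_+(\Bbbk)$, $$\lVert A\rVert_\gamma^{\Bbbk}\le K_{\mathsf{C},d,\infty}^{\Bbbk}\,\lVert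 A\rVert_{\gamma,d}^{\Bbbk}$$ with the above values of the constant. For $d=1$ the constants are $K_{\mathsf{C},1,\infty}^{\mathbb{R}}=\pi/2$ and $K_{\mathsf{C},1,\infty}^{\mathbb{C}}=4/\pi$, so that this inequality contains the Nesterov $\pi/2$-Theorem and the Ben-Tal--Nemirovski--Roos $4/\pi$-Theorem. -/

import Mathlib

open Filter Topology
open scoped ENNReal

/-- The `(γ, d)`-seminorm of an `n × n` matrix over `𝕜 = ℝ` or `ℂ`: the maximum of
`|∑ i, ∑ j, a i j * ⟨x i, x j⟩|` over all unit vectors `x 1, …, x n` of `𝕜 ^ d`. For `1 ≤ d` the set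
below is the image of a nonempty compact set under a continuous map, so that its supremum is
a maximum. The inner product is conjugate-linear in the first argument: `⟨x, y⟩ = x* y`. -/
noncomputable def gammaSeminorm {𝕜 : Type*} [RCLike 𝕜] {n : ℕ} (d : ℕ)
    (A : Matrix (Fin n) (Fin n) 𝕜) : ℝ :=
  sSup {r : ℝ | ∃ x : Fin n → EuclideanSpace 𝕜 (Fin d),
    (∀ i, ‖x i‖ = 1) ∧ r = ‖∑ i, ∑ j, A i j * inner 𝕜 (x i) (x j)‖}

/-- The `γ`-seminorm of an `n × n` matrix: the `(γ, n)`-seminorm. -/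
noncomputable def gammaSeminormFull {𝕜 : Type*} [RCLike 𝕜] {n : ℕ}
    (A : Matrix (Fin n) (Fin n) 𝕜) : ℝ :=
  gammaSeminorm n A

open scoped ComplexOrder in
/-- The family of cones of positive semidefinite (real symmetric or complex Hermitian)
`n × n` matrices, `n ∈ ℕ`. -/
def psdCones (𝕜 : Type*) [RCLike 𝕜] (n : ℕ) : Set (Matrix (Fin n) (Fin n) 𝕜) :=
  {A | A.PosSemidef}

/-- The conic Grothendieck constant `K_{C,d,p}` of a family of cones `C n`: the supremum over all
`n` and all `A ∈ C n` of the ratio of the `(γ, p)`-seminorm to the `(γ, d)`-seminorm of `A`.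
It is taken in `[0, ∞]`, where `0 / 0 = 0` (so that `A = 0` does not contribute) and `a / 0 = ∞`
for `a ≠ 0`. -/
noncomputable def conicConst {𝕜 : Type*} [RCLike 𝕜] (C : ∀ n : ℕ, Set (Matrix (Fin n) (Fin n) 𝕜))
    (d p : ℕ) : ℝ≥0∞ :=
  ⨆ n : ℕ, ⨆ A ∈ C n, ENNReal.ofReal (gammaSeminorm p A) / ENNReal.ofReal (gammaSeminorm d A)

/-! Let k be the real dimension of 𝕜, g a standard Gaussian vector in real dimension N, and ρ_N =
(E‖g‖)² / E‖g‖², which is `gaussRatio N`. Everything follows from ρ_{kp} / ρ_{kd} ≤ K_{C,d,p} ≤ 1 /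
ρ_{kd} together with ρ_N → 1.

Upper bound (`gaussRatio_mul_norm_sum_le`): round unit vectors x_i of 𝕜^p to φ(G x_i), with G a
Gaussian d × p matrix and φ(v) = v / ‖v‖. Remove the linear part of φ by setting ψ(v) = φ(v) - α v,
α = E‖g‖ / E‖g‖² for N = kd. Then E⟨ψ(Gx), ψ(Gy)⟩ = E⟨φ(Gx), φ(Gy)⟩ - ρ_{kd} ⟨x, y⟩ for unit x, y.
Summed against a positive semidefinite A the left side is nonnegative, so ρ_{kd} ∑ a_ij ⟨x_i, x_j⟩
is at most the mean of the rounded values, hence at most the (γ, d)-seminorm.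

Lower bound (`exists_psd_gammaSeminorm_bounds`): take the kernel ⟨u_j, u_i⟩ on 𝕜^p weighted by a
discretized Gaussian measure. Its value at x is the squared Frobenius norm of M = ∑ w_i u_i x_i*. In
dimension p, x_i = u_i / ‖u_i‖ gives tr M ≈ E‖g‖ with N = kp, so ‖M‖² ≥ |tr M|² / p ≈ k ρ_{kp}. In
dimension d, ‖M‖² = ∑ w_i ⟨x_i, M* u_i⟩ is at most about E‖M* g‖. As M* g lies in 𝕜^d,
`integral_norm_map_sq_le` bounds this by √(k ρ_{kd}) ‖M‖, whence ‖M‖² is at most about k ρ_{kd}. -/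

open MeasureTheory ProbabilityTheory

/-- The mean norm of a standard Gaussian vector in dimension `N`. -/
noncomputable def gaussMeanNorm (N : ℕ) : ℝ :=
  √2 * Real.Gamma (((N : ℝ) + 1) / 2) / Real.Gamma ((N : ℝ) / 2)

lemma gaussMeanNorm_pos {N : ℕ} (hN : 0 < N) : 0 < gaussMeanNorm N := by
  have hG : 0 < Real.Gamma ((N : ℝ) / 2) := Real.Gamma_pos_of_pos (by positivity)
  have hG' : 0 < Real.Gamma (((N : ℝ) + 1) / 2) := Real.Gamma_pos_of_pos (by positivity)
  unfold gaussMeanNorm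
  positivity

/-- The squared mean norm of a standard Gaussian vector in dimension `N`, divided by its mean
squared norm. -/
noncomputable def gaussRatio (N : ℕ) : ℝ :=
  gaussMeanNorm N ^ 2 / N

lemma gaussRatio_pos {N : ℕ} (hN : 0 < N) : 0 < gaussRatio N := by
  have := gaussMeanNorm_pos hN
  unfold gaussRatio
  positivity

/-! ### Norm moments of Gaussian vectors and of their linear images. -/

section RealGaussian

variable {E F : Type*} [NormedAddCommGroup E] [InnerProductSpace ℝ E] [FiniteDimensional ℝ E]
  [MeasurableSpace E] [BorelSpace E] [NormedAddCommGroup F] [InnerProductSpace ℝ F]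
  [FiniteDimensional ℝ F]

/-- A map with a norm preserving formal adjoint sends the standard Gaussian measure to the
standard Gaussian measure. -/
lemma stdGaussian_map_of_adjoint_norm [MeasurableSpace F] [BorelSpace F] (L : E → F) (M : F → E) (hL : Measurable L)
    (hadj : ∀ g t, inner ℝ (L g) t = inner ℝ g (M t)) (hM : ∀ t, ‖M t‖ = ‖t‖) :
    (stdGaussian E).map L = stdGaussian F := by
  have := Measure.isProbabilityMeasure_map (μ := stdGaussian E) hL.aemeasurable
  apply Measure.ext_of_charFun
  ext t
  rw [charFun_stdGaussian, charFun_apply, integral_map hL.aemeasurable (by fun_prop)]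
  simp_rw [hadj]
  rw [← charFun_apply, charFun_stdGaussian, hM]

variable (E) in
-- Polar coordinates reduce the integral to a one-dimensional Gamma integral.
lemma integral_norm_pow_mul_exp [Nontrivial E] (q : ℕ) :
    ∫ x : E, ‖x‖ ^ q * Real.exp (-(1 / 2) * ‖x‖ ^ 2) =
      Module.finrank ℝ E * (volume : Measure E).real (Metric.ball 0 1) *
        ((1 / 2 : ℝ) ^ (-((Module.finrank ℝ E + q : ℕ) : ℝ) / 2) * (1 / 2) *
          Real.Gamma (((Module.finrank ℝ E + q : ℕ) : ℝ) / 2)) := by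
  have h := integral_fun_norm_addHaar (volume : Measure E)
    (fun r : ℝ ↦ r ^ q * Real.exp (-(1 / 2) * r ^ 2))
  have hN : 0 < Module.finrank ℝ E := Module.finrank_pos
  rw [h, nsmul_eq_mul, smul_eq_mul, ← mul_assoc]
  congr 1
  have h2 := integral_rpow_mul_exp_neg_mul_rpow (p := 2)
    (q := ((Module.finrank ℝ E - 1 + q : ℕ) : ℝ)) (b := 1 / 2) (by norm_num)
    (lt_of_lt_of_le (by norm_num) (Nat.cast_nonneg _)) (by norm_num)
  have h3 : ((Module.finrank ℝ E - 1 + q : ℕ) : ℝ) + 1 = ((Module.finrank ℝ E + q : ℕ) : ℝ) := by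
    rw [← Nat.cast_add_one]
    congr 1
    omega
  rw [h3] at h2
  have h4 : -((Module.finrank ℝ E - 1 + q : ℕ) : ℝ) - 1 = -((Module.finrank ℝ E + q : ℕ) : ℝ) := by
    rw [← h3]; ring
  rw [← h2]
  apply setIntegral_congr_fun measurableSet_Ioi
  intro x _
  simp only [smul_eq_mul, Real.rpow_natCast, Real.rpow_two]
  rw [← mul_assoc, ← pow_add]

variable (E) in
lemma integrable_norm_pow_mul_exp [Nontrivial E] (q : ℕ) :
    Integrable (fun x : E ↦ ‖x‖ ^ q * Real.exp (-(1 / 2) * ‖x‖ ^ 2)) := by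
  -- The Bochner integral of a non-integrable function is 0, so the positive closed form already
  -- proves integrability.
  refine Integrable.of_integral_ne_zero ?_
  rw [integral_norm_pow_mul_exp E q]
  have hN : 0 < Module.finrank ℝ E := Module.finrank_pos
  have hb : 0 < (volume : Measure E).real (Metric.ball 0 1) :=
    ENNReal.toReal_pos (Metric.measure_ball_pos volume 0 one_pos).ne' measure_ball_lt_top.ne
  have hG : 0 < Real.Gamma (((Module.finrank ℝ E + q : ℕ) : ℝ) / 2) :=
    Real.Gamma_pos_of_pos (by positivity)
  positivity

variable (E) in
-- Both sides have the same characteristic function; the density is what allows polar coordinates.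
lemma stdGaussian_eq_withDensity [Nontrivial E] :
    stdGaussian E = volume.withDensity (fun x : E ↦ ENNReal.ofReal
      ((∫ x : E, Real.exp (-(1 / 2) * ‖x‖ ^ 2))⁻¹ * Real.exp (-(1 / 2) * ‖x‖ ^ 2))) := by
  have hi : Integrable (fun x : E ↦ Real.exp (-(1 / 2) * ‖x‖ ^ 2)) := by
    simpa using integrable_norm_pow_mul_exp E 0
  have hZ : 0 < ∫ x : E, Real.exp (-(1 / 2) * ‖x‖ ^ 2) := integral_exp_pos hi
  have hfin : IsFiniteMeasure (volume.withDensity (fun x : E ↦ ENNReal.ofReal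
      ((∫ x : E, Real.exp (-(1 / 2) * ‖x‖ ^ 2))⁻¹ * Real.exp (-(1 / 2) * ‖x‖ ^ 2)))) :=
    isFiniteMeasure_withDensity_ofReal (hi.const_mul _).2
  apply Measure.ext_of_charFun
  ext t
  rw [charFun_stdGaussian, charFun_apply,
    integral_withDensity_eq_integral_toReal_smul (by fun_prop) (by simp)]
  have h1 := GaussianFourier.integral_cexp_neg_mul_sq_norm_add (V := E) (b := 1 / 2)
    (by norm_num) Complex.I t
  have h0 := GaussianFourier.integral_cexp_neg_mul_sq_norm (V := E) (b := 1 / 2) (by norm_num)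
  have hZ' : ((∫ x : E, Real.exp (-(1 / 2) * ‖x‖ ^ 2) : ℝ) : ℂ) =
      ∫ v : E, Complex.exp (-(1 / 2) * (‖v‖ : ℂ) ^ 2) := by
    rw [← integral_complex_ofReal]
    congr 1
    ext x
    push_cast
    rfl
  have : ∀ x : E, (ENNReal.ofReal ((∫ x : E, Real.exp (-(1 / 2) * ‖x‖ ^ 2))⁻¹ *
      Real.exp (-(1 / 2) * ‖x‖ ^ 2))).toReal • Complex.exp ((inner ℝ x t : ℝ) * Complex.I) =
      ((∫ x : E, Real.exp (-(1 / 2) * ‖x‖ ^ 2) : ℝ) : ℂ)⁻¹ *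
        Complex.exp (-(1 / 2) * (‖x‖ : ℂ) ^ 2 + Complex.I * (inner ℝ t x : ℝ)) := by
    intro x
    rw [ENNReal.toReal_ofReal (by positivity), Complex.real_smul, Complex.exp_add,
      real_inner_comm]
    push_cast
    ring_nf
  simp_rw [this]
  rw [integral_const_mul, h1, ← h0, ← hZ', ← mul_assoc,
    inv_mul_cancel₀ (by exact_mod_cast hZ.ne'), one_mul, Complex.I_sq]
  congr 1
  ring

lemma integrable_norm_stdGaussian : Integrable (fun x : E ↦ ‖x‖) (stdGaussian E) :=
  (IsGaussian.integrable_id (μ := stdGaussian E)).norm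

lemma integrable_norm_sq_stdGaussian : Integrable (fun x : E ↦ ‖x‖ ^ 2) (stdGaussian E) :=
  (IsGaussian.memLp_two_id (μ := stdGaussian E)).integrable_norm_pow (by norm_num)

variable (E) in
lemma integral_norm_pow_stdGaussian [Nontrivial E] (q : ℕ) :
    ∫ x, ‖x‖ ^ q ∂(stdGaussian E) = (∫ x : E, Real.exp (-(1 / 2) * ‖x‖ ^ 2))⁻¹ *
      ∫ x : E, ‖x‖ ^ q * Real.exp (-(1 / 2) * ‖x‖ ^ 2) := by
  rw [stdGaussian_eq_withDensity E,
    integral_withDensity_eq_integral_toReal_smul (by fun_prop) (by simp), ← integral_const_mul]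
  congr 1
  ext x
  have hZ : 0 ≤ ∫ x : E, Real.exp (-(1 / 2) * ‖x‖ ^ 2) :=
    integral_nonneg fun _ ↦ (Real.exp_pos _).le
  rw [ENNReal.toReal_ofReal (by positivity), smul_eq_mul]
  ring

variable (E) in
lemma integral_norm_stdGaussian [Nontrivial E] :
    ∫ x, ‖x‖ ∂(stdGaussian E) = gaussMeanNorm (Module.finrank ℝ E) := by
  have h := integral_norm_pow_stdGaussian E 1
  have h0 := integral_norm_pow_mul_exp E 0
  rw [integral_norm_pow_mul_exp E 1] at h
  simp only [pow_one, pow_zero, one_mul, add_zero] at h h0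
  have hN : 0 < Module.finrank ℝ E := Module.finrank_pos
  have hb : 0 < (volume : Measure E).real (Metric.ball 0 1) :=
    ENNReal.toReal_pos (Metric.measure_ball_pos volume 0 one_pos).ne' measure_ball_lt_top.ne
  have hG : 0 < Real.Gamma ((Module.finrank ℝ E : ℝ) / 2) :=
    Real.Gamma_pos_of_pos (by positivity)
  rw [h, h0, gaussMeanNorm]
  have h2 : ((1 / 2 : ℝ)) ^ (-((Module.finrank ℝ E + 1 : ℕ) : ℝ) / 2) =
      (1 / 2 : ℝ) ^ (-(Module.finrank ℝ E : ℝ) / 2) * √2 := by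
    rw [Real.sqrt_eq_rpow, show (2 : ℝ) ^ (1 / 2 : ℝ) = (1 / 2 : ℝ) ^ (-(1 / 2) : ℝ) by
      rw [one_div, Real.inv_rpow (by norm_num), Real.rpow_neg (by norm_num), inv_inv],
      ← Real.rpow_add (by norm_num)]
    congr 1
    push_cast
    ring
  have h3 : 0 < (1 / 2 : ℝ) ^ (-(Module.finrank ℝ E : ℝ) / 2) := by positivity
  rw [h2]
  field_simp
  push_cast
  ring

variable (E) in
lemma integral_norm_sq_stdGaussian :
    ∫ x, ‖x‖ ^ 2 ∂(stdGaussian E) = Module.finrank ℝ E := by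
  let b := stdOrthonormalBasis ℝ E
  have h : ∀ x : E, ‖x‖ ^ 2 = ∑ i, (inner ℝ (b i) x) ^ 2 := fun x ↦
    (b.sum_sq_inner_right x).symm
  simp_rw [h]
  have hi : ∀ i, Integrable (fun x : E ↦ (inner ℝ (b i) x) ^ 2) (stdGaussian E) := fun i ↦ by
    refine (integrable_norm_sq_stdGaussian (E := E)).mono' (by fun_prop) (ae_of_all _ fun x ↦ ?_)
    rw [Real.norm_of_nonneg (by positivity), ← sq_abs]
    gcongr
    simpa using abs_real_inner_le_norm (b i) x
  rw [integral_finsetSum _ fun i _ ↦ hi i]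
  have : ∀ i, ∫ x, (inner ℝ (b i) x) ^ 2 ∂(stdGaussian E) = 1 := fun i ↦ by
    have h1 := variance_dual_stdGaussian (innerSL ℝ (b i))
    rw [variance_of_integral_eq_zero (by fun_prop)
      (integral_strongDual_stdGaussian (innerSL ℝ (b i)))] at h1
    simpa using h1
  simp [this]

/-- Rotation invariance determines the second moments of a radially weighted Gaussian. -/
lemma integral_inner_sq_mul_radial (w : ℝ → ℝ) (hw : Measurable w)
    (hi : Integrable (fun x : E ↦ ‖x‖ ^ 2 * w ‖x‖) (stdGaussian E)) (a : E) :
    Integrable (fun x : E ↦ (inner ℝ a x) ^ 2 * w ‖x‖) (stdGaussian E) ∧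
    Module.finrank ℝ E * ∫ x, (inner ℝ a x) ^ 2 * w ‖x‖ ∂(stdGaussian E) =
      ‖a‖ ^ 2 * ∫ x, ‖x‖ ^ 2 * w ‖x‖ ∂(stdGaussian E) := by
  have hint : ∀ a : E, Integrable (fun x : E ↦ (inner ℝ a x) ^ 2 * w ‖x‖) (stdGaussian E) := by
    intro a
    refine (hi.norm.const_mul (‖a‖ ^ 2)).mono'
      (by fun_prop) (ae_of_all _ fun x ↦ ?_)
    rw [norm_mul, norm_mul, ← mul_assoc]
    gcongr
    rw [Real.norm_of_nonneg (by positivity), Real.norm_of_nonneg (by positivity), ← sq_abs,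
      ← mul_pow]
    gcongr
    exact abs_real_inner_le_norm a x
  refine ⟨hint a, ?_⟩
  let b := stdOrthonormalBasis ℝ E
  have hk : ∀ k, ∫ x, (inner ℝ a x) ^ 2 * w ‖x‖ ∂(stdGaussian E) =
      ‖a‖ ^ 2 * ∫ x, (inner ℝ (b k) x) ^ 2 * w ‖x‖ ∂(stdGaussian E) := by
    intro k
    -- The reflection exchanging a and ‖a‖ b_k preserves both the Gaussian measure and the radial
    -- weight. Averaging over k then produces the full squared norm.
    let v := ‖a‖ • b k
    have hv : ‖a‖ = ‖v‖ := by simp [v, norm_smul]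
    let R := (Submodule.span ℝ {a - v})ᗮ.reflection
    have hR : R a = v := Submodule.reflection_sub hv
    have hmap := stdGaussian_map R
    calc _ = ∫ x, (inner ℝ (R a) (R x)) ^ 2 * w ‖R x‖ ∂(stdGaussian E) := by
          simp_rw [LinearIsometryEquiv.inner_map_map, LinearIsometryEquiv.norm_map]
      _ = ∫ x, (inner ℝ v x) ^ 2 * w ‖x‖ ∂((stdGaussian E).map R) := by
          rw [integral_map (by fun_prop) (by fun_prop), hR]
      _ = _ := by
          rw [hmap, ← integral_const_mul]
          simp_rw [v, real_inner_smul_left, mul_pow, mul_assoc]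
  have hs : ∫ x, ‖x‖ ^ 2 * w ‖x‖ ∂(stdGaussian E) =
      ∑ k, ∫ x, (inner ℝ (b k) x) ^ 2 * w ‖x‖ ∂(stdGaussian E) := by
    rw [← integral_finsetSum _ fun k _ ↦ hint (b k)]
    simp_rw [← Finset.sum_mul, b.sum_sq_inner_right]
  rw [hs, Finset.mul_sum, ← Finset.sum_congr rfl fun k _ ↦ hk k]
  simp

lemma integral_norm_map_sq_mul_radial {ι : Type*} [Fintype ι] (b : OrthonormalBasis ι ℝ F)
    (w : ℝ → ℝ) (hw : Measurable w)
    (hi : Integrable (fun x : E ↦ ‖x‖ ^ 2 * w ‖x‖) (stdGaussian E)) (T : E →L[ℝ] F) :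
    Integrable (fun x : E ↦ ‖T x‖ ^ 2 * w ‖x‖) (stdGaussian E) ∧
    Module.finrank ℝ E * ∫ x, ‖T x‖ ^ 2 * w ‖x‖ ∂(stdGaussian E) =
      (∑ l, ‖T.adjoint (b l)‖ ^ 2) * ∫ x, ‖x‖ ^ 2 * w ‖x‖ ∂(stdGaussian E) := by
  have h : ∀ x, ‖T x‖ ^ 2 * w ‖x‖ = ∑ l, (inner ℝ (T.adjoint (b l)) x) ^ 2 * w ‖x‖ := fun x ↦ by
    rw [← Finset.sum_mul, ← b.sum_sq_inner_right (T x)]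
    simp_rw [ContinuousLinearMap.adjoint_inner_left]
  have hl := fun l ↦ integral_inner_sq_mul_radial w hw hi (T.adjoint (b l))
  simp_rw [h]
  refine ⟨integrable_finsetSum _ fun l _ ↦ (hl l).1, ?_⟩
  rw [integral_finsetSum _ fun l _ ↦ (hl l).1, Finset.mul_sum, Finset.sum_mul]
  exact Finset.sum_congr rfl fun l _ ↦ (hl l).2

/-- Cauchy–Schwarz gives (E‖Tx‖)² ≤ E(‖Tx‖² / ‖x‖) · E‖x‖. Rotation invariance evaluates E(‖Tx‖² /
‖x‖) and E‖Tx‖² as the same multiple of E‖x‖ and E‖x‖², so their quotient does not depend on T. -/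
lemma integral_norm_map_sq_le_of_nontrivial [Nontrivial E] (T : E →L[ℝ] F) :
    (∫ x, ‖T x‖ ∂(stdGaussian E)) ^ 2 ≤
      gaussRatio (Module.finrank ℝ E) *
        ∫ x, ‖T x‖ ^ 2 ∂(stdGaussian E) := by
  have hN : (0 : ℝ) < Module.finrank ℝ E := by exact_mod_cast Module.finrank_pos
  have hw1 : ∀ x : E, ‖x‖ ^ 2 * ‖x‖⁻¹ = ‖x‖ := fun x ↦ by
    rcases eq_or_ne ‖x‖ 0 with h | h
    · simp [h]
    · field_simp
  obtain ⟨hi1, h1⟩ := integral_norm_map_sq_mul_radial (stdOrthonormalBasis ℝ F) (fun r ↦ r⁻¹)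
    (by fun_prop) (by simpa only [hw1] using integrable_norm_stdGaussian (E := E)) T
  obtain ⟨hi2, h2⟩ := integral_norm_map_sq_mul_radial (stdOrthonormalBasis ℝ F) (fun _ ↦ 1)
    (by fun_prop) (by simpa using integrable_norm_sq_stdGaussian (E := E)) T
  simp only [hw1, mul_one] at h1 h2
  rw [integral_norm_sq_stdGaussian, mul_comm] at h2
  rw [integral_norm_stdGaussian, ← mul_right_cancel₀ hN.ne' h2] at h1
  have hμ : 0 < gaussMeanNorm (Module.finrank ℝ E) := gaussMeanNorm_pos Module.finrank_pos
  have hiT : Integrable (fun x ↦ ‖T x‖) (stdGaussian E) :=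
    (T.integrable_comp (IsGaussian.integrable_id (μ := stdGaussian E))).norm
  -- Cauchy–Schwarz in quadratic form: integrate (‖Tx‖ - t‖x‖)² / ‖x‖ ≥ 0.
  have key : ∀ t : ℝ, 2 * t * ∫ x, ‖T x‖ ∂(stdGaussian E) ≤
      (∫ x, ‖T x‖ ^ 2 * ‖x‖⁻¹ ∂(stdGaussian E)) +
        t ^ 2 * gaussMeanNorm (Module.finrank ℝ E) := by
    intro t
    rw [← integral_norm_stdGaussian, ← integral_const_mul, ← integral_const_mul,
      ← integral_add hi1 (integrable_norm_stdGaussian.const_mul _)]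
    refine integral_mono (hiT.const_mul _)
      (hi1.add (integrable_norm_stdGaussian.const_mul _)) fun x ↦ ?_
    dsimp only
    rcases eq_or_ne x 0 with rfl | h
    · simp
    · have hx : 0 < ‖x‖ := norm_pos_iff.2 h
      rw [← sub_nonneg]
      have : ‖T x‖ ^ 2 * ‖x‖⁻¹ + t ^ 2 * ‖x‖ - 2 * t * ‖T x‖ =
          (‖T x‖ - t * ‖x‖) ^ 2 * ‖x‖⁻¹ := by
        field_simp
        ring
      rw [this]
      positivity
  rw [gaussRatio]
  generalize (∫ x, ‖T x‖ ∂(stdGaussian E)) = X at key ⊢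
  generalize gaussMeanNorm (Module.finrank ℝ E) = μ at *
  generalize (∫ x, ‖T x‖ ^ 2 * ‖x‖⁻¹ ∂(stdGaussian E)) = a at *
  -- The optimal t.
  have h3 := key (X / μ)
  have h4 : X ^ 2 ≤ a * μ := by
    have : 2 * (X / μ) * X - (X / μ) ^ 2 * μ = X ^ 2 / μ := by
      field_simp
      ring
    rw [← div_le_iff₀ hμ]
    linarith
  calc X ^ 2 ≤ a * μ := h4
    _ = _ := by
      field_simp
      rw [mul_comm a, h1]
      ring

/-- A linear image of a standard Gaussian vector in dimension at most `N` has mean norm at most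
`√(gaussRatio N)` times its root mean square norm. -/
lemma integral_norm_map_sq_le (T : E →L[ℝ] F) (hF : 0 < Module.finrank ℝ F)
    (hFE : Module.finrank ℝ F ≤ Module.finrank ℝ E) :
    (∫ x, ‖T x‖ ∂(stdGaussian E)) ^ 2 ≤
      gaussRatio (Module.finrank ℝ F) *
        ∫ x, ‖T x‖ ^ 2 ∂(stdGaussian E) := by
  -- T factors through the projection onto Kᗮ for any K inside its kernel. Choosing K of dimension
  -- exactly dim E - dim F makes Kᗮ have dimension dim F, whatever the rank of T, and the projected
  -- vector is standard Gaussian there.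
  have hker : Module.finrank ℝ E - Module.finrank ℝ F ≤ Module.finrank ℝ T.ker := by
    have h1 := T.toLinearMap.finrank_range_add_finrank_ker
    have h2 := Submodule.finrank_le T.toLinearMap.range
    omega
  obtain ⟨f, hf⟩ := exists_linearIndependent_of_le_finrank hker
  let K : Submodule ℝ E := (Submodule.span ℝ (Set.range f)).map T.ker.subtype
  have hKT : K ≤ T.ker := Submodule.map_subtype_le _ _
  have hK : Module.finrank ℝ K = Module.finrank ℝ E - Module.finrank ℝ F := by
    rw [Submodule.finrank_map_subtype_eq, finrank_span_eq_card hf, Fintype.card_fin]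
  have hW : Module.finrank ℝ Kᗮ = Module.finrank ℝ F := by
    have := K.finrank_add_finrank_orthogonal
    omega
  have hnt : Nontrivial Kᗮ := Module.nontrivial_of_finrank_pos (R := ℝ) (by omega)
  have hmap : (stdGaussian E).map Kᗮ.orthogonalProjectionOnto = stdGaussian Kᗮ :=
    stdGaussian_map_of_adjoint_norm _ (fun t ↦ (t : E)) (by fun_prop)
      (fun g t ↦ Submodule.inner_orthogonalProjectionOnto_eq_of_mem_right t g) (fun t ↦ rfl)
  have hT : ∀ x, T x = (T.comp Kᗮ.subtypeL) (Kᗮ.orthogonalProjectionOnto x) := fun x ↦ by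
    have h := K.starProjection_add_starProjection_orthogonal x
    have h2 : T (K.starProjection x) = 0 := hKT (K.starProjection_apply_mem x)
    calc T x = T (K.starProjection x + Kᗮ.starProjection x) := by rw [h]
      _ = T (Kᗮ.starProjection x) := by rw [map_add, h2, zero_add]
      _ = _ := rfl
  have := integral_norm_map_sq_le_of_nontrivial (T.comp Kᗮ.subtypeL)
  rw [hW, ← hmap, integral_map (by fun_prop) (by fun_prop),
    integral_map (by fun_prop) (by fun_prop)] at this
  simpa only [← hT] using this

end RealGaussian

/-! ### Gaussian matrices and the correlation of their values at two vectors. -/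

section GaussianMatrix

variable {𝕜 : Type*} [RCLike 𝕜] {d p : ℕ}

lemma EuclideanSpace.real_inner_eq_re_inner (x y : EuclideanSpace 𝕜 (Fin d)) :
    inner ℝ x y = RCLike.re (inner 𝕜 x y) := by
  simp only [PiLp.inner_apply, map_sum]
  rfl

variable (𝕜 d) in
lemma finrank_real_euclideanSpace :
    Module.finrank ℝ (EuclideanSpace 𝕜 (Fin d)) = Module.finrank ℝ 𝕜 * d := by
  rw [← Module.finrank_mul_finrank ℝ 𝕜, finrank_euclideanSpace_fin]

variable (𝕜 d p) in
/-- `d × p` matrices, as `p`-tuples of columns. -/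
abbrev ColumnMatrix : Type _ := PiLp 2 (fun _ : Fin p ↦ EuclideanSpace 𝕜 (Fin d))

namespace ColumnMatrix

/-- Application of a matrix to a vector. -/
noncomputable def eval (x : EuclideanSpace 𝕜 (Fin p)) :
    ColumnMatrix 𝕜 d p →L[𝕜] EuclideanSpace 𝕜 (Fin d) :=
  ∑ k, x k • PiLp.proj 2 (fun _ : Fin p ↦ EuclideanSpace 𝕜 (Fin d)) k

lemma eval_apply (x : EuclideanSpace 𝕜 (Fin p)) (G : ColumnMatrix 𝕜 d p) :
    eval x G = ∑ k, x k • G k := by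
  simp [eval]

/-- The adjoint of `eval x`, sending `t` to the rank one matrix `t x*`. -/
noncomputable def coeval (x : EuclideanSpace 𝕜 (Fin p)) (t : EuclideanSpace 𝕜 (Fin d)) :
    ColumnMatrix 𝕜 d p :=
  WithLp.toLp 2 fun k ↦ (starRingEnd 𝕜) (x k) • t

lemma eval_coeval (x y : EuclideanSpace 𝕜 (Fin p)) (t : EuclideanSpace 𝕜 (Fin d)) :
    eval y (coeval x t) = inner 𝕜 x y • t := by
  simp [eval_apply, coeval, smul_smul, PiLp.inner_apply, Finset.sum_smul]

lemma real_inner_eval (x : EuclideanSpace 𝕜 (Fin p)) (G : ColumnMatrix 𝕜 d p)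
    (t : EuclideanSpace 𝕜 (Fin d)) : inner ℝ (eval x G) t = inner ℝ G (coeval x t) := by
  rw [EuclideanSpace.real_inner_eq_re_inner, eval_apply, PiLp.inner_apply G, sum_inner, map_sum]
  refine Finset.sum_congr rfl fun k _ ↦ ?_
  rw [EuclideanSpace.real_inner_eq_re_inner, coeval, inner_smul_left]
  exact congrArg _ (inner_smul_right (G k) t _).symm

variable {x : EuclideanSpace 𝕜 (Fin p)}

lemma eval_coeval_self (hx : ‖x‖ = 1) (t : EuclideanSpace 𝕜 (Fin d)) : eval x (coeval x t) = t := by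
  rw [eval_coeval, inner_self_eq_norm_sq_to_K, hx]
  simp

lemma norm_coeval (hx : ‖x‖ = 1) (t : EuclideanSpace 𝕜 (Fin d)) : ‖coeval x t‖ = ‖t‖ := by
  have h : ‖coeval x t‖ ^ 2 = ‖t‖ ^ 2 := by
    rw [← real_inner_self_eq_norm_sq, ← real_inner_eval, eval_coeval_self hx,
      real_inner_self_eq_norm_sq]
  exact (sq_eq_sq₀ (norm_nonneg _) (norm_nonneg _)).1 h

lemma stdGaussian_map_eval (hx : ‖x‖ = 1) :
    (stdGaussian (ColumnMatrix 𝕜 d p)).map (eval x) = stdGaussian (EuclideanSpace 𝕜 (Fin d)) :=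
  stdGaussian_map_of_adjoint_norm _ (coeval x) (eval x).continuous.measurable (real_inner_eval x)
    (norm_coeval hx)

lemma norm_reflection (hx : ‖x‖ = 1) (t : ColumnMatrix 𝕜 d p) :
    ‖(2 : ℝ) • coeval x (eval x t) - t‖ = ‖t‖ := by
  have h : ‖(2 : ℝ) • coeval x (eval x t) - t‖ ^ 2 = ‖t‖ ^ 2 := by
    rw [norm_sub_sq_real, norm_smul, norm_coeval hx, real_inner_smul_left, real_inner_comm,
      ← real_inner_eval, real_inner_self_eq_norm_sq, mul_pow, Real.norm_of_nonneg (by norm_num)]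
    ring
  exact (sq_eq_sq₀ (norm_nonneg _) (norm_nonneg _)).1 h

lemma continuous_coeval :
    Continuous (coeval x : EuclideanSpace 𝕜 (Fin d) → ColumnMatrix 𝕜 d p) := by
  unfold coeval
  fun_prop

/-- The map G ↦ 2 G x x* - G is self-adjoint and isometric. It fixes G x and negates G y for y
orthogonal to x. -/
lemma stdGaussian_map_reflection (hx : ‖x‖ = 1) :
    (stdGaussian (ColumnMatrix 𝕜 d p)).map (fun G ↦ (2 : ℝ) • coeval x (eval x G) - G) =
      stdGaussian (ColumnMatrix 𝕜 d p) := by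
  refine stdGaussian_map_of_adjoint_norm _ (fun G ↦ (2 : ℝ) • coeval x (eval x G) - G)
    ?_ (fun G H ↦ ?_) (norm_reflection hx)
  · have := continuous_coeval (𝕜 := 𝕜) (x := x) (d := d)
    exact Continuous.measurable (by fun_prop)
  · rw [inner_sub_left, inner_sub_right, real_inner_smul_left, real_inner_smul_right,
      ← real_inner_eval, real_inner_comm, ← real_inner_eval, real_inner_comm]

/-- The growth condition on φ covers both normalization and the identity. -/
lemma integrable_inner_eval (y : EuclideanSpace 𝕜 (Fin p))
    {φ : EuclideanSpace 𝕜 (Fin d) → EuclideanSpace 𝕜 (Fin d)} (hφ : Measurable φ)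
    (hb : ∀ v, ‖φ v‖ ≤ 1 + ‖v‖) :
    Integrable (fun G ↦ inner 𝕜 (φ (eval x G)) (eval y G))
      (stdGaussian (ColumnMatrix 𝕜 d p)) := by
  have hm : Measurable (eval x : ColumnMatrix 𝕜 d p → _) := (eval x).continuous.measurable
  have hm' : Measurable (eval y : ColumnMatrix 𝕜 d p → _) := (eval y).continuous.measurable
  refine Integrable.mono' (g := fun G ↦ ‖(eval y : ColumnMatrix 𝕜 d p →L[𝕜] _)‖ * ‖G‖ +
    ‖(eval x : ColumnMatrix 𝕜 d p →L[𝕜] _)‖ * ‖(eval y : ColumnMatrix 𝕜 d p →L[𝕜] _)‖ * ‖G‖ ^ 2)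
    ((integrable_norm_stdGaussian.const_mul _).add (integrable_norm_sq_stdGaussian.const_mul _))
    ((hφ.comp hm).inner hm').aestronglyMeasurable
    (ae_of_all _ fun G ↦ ?_)
  calc _ ≤ ‖φ (eval x G)‖ * ‖eval y G‖ := norm_inner_le_norm _ _
    _ ≤ (1 + ‖(eval x : ColumnMatrix 𝕜 d p →L[𝕜] _)‖ * ‖G‖) *
        (‖(eval y : ColumnMatrix 𝕜 d p →L[𝕜] _)‖ * ‖G‖) := by
      gcongr
      · exact (hb _).trans (by gcongr; exact ContinuousLinearMap.le_opNorm _ _)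
      · exact ContinuousLinearMap.le_opNorm _ _
    _ = _ := by ring

/-- For a Gaussian matrix `G`, the vectors `φ (G x)` and `G y` are correlated only through the
component of `y` along the unit vector `x`. -/
lemma integral_inner_eval (hx : ‖x‖ = 1) (y : EuclideanSpace 𝕜 (Fin p))
    {φ : EuclideanSpace 𝕜 (Fin d) → EuclideanSpace 𝕜 (Fin d)} (hφ : Measurable φ)
    (hb : ∀ v, ‖φ v‖ ≤ 1 + ‖v‖) :
    ∫ G, inner 𝕜 (φ (eval x G)) (eval y G) ∂(stdGaussian (ColumnMatrix 𝕜 d p)) =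
      inner 𝕜 x y * ∫ h, inner 𝕜 (φ h) h ∂(stdGaussian (EuclideanSpace 𝕜 (Fin d))) := by
  have hm : ∀ z, Measurable (eval z : ColumnMatrix 𝕜 d p → _) := fun z ↦
    (eval z).continuous.measurable
  have hR : Measurable fun G : ColumnMatrix 𝕜 d p ↦ (2 : ℝ) • coeval x (eval x G) - G := by
    have := continuous_coeval (𝕜 := 𝕜) (x := x) (d := d)
    exact Continuous.measurable (by fun_prop)
  -- The reflection fixes G x and sends G y to 2⟨x, y⟩ G x - G y. So the integral I satisfies I =
  -- 2⟨x, y⟩ J - I, where J is its value at y = x.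
  have h1 : ∫ G, inner 𝕜 (φ (eval x G)) (eval y G) ∂(stdGaussian (ColumnMatrix 𝕜 d p)) =
      ∫ G, (2 * inner 𝕜 x y * inner 𝕜 (φ (eval x G)) (eval x G) -
        inner 𝕜 (φ (eval x G)) (eval y G)) ∂(stdGaussian (ColumnMatrix 𝕜 d p)) := by
    conv_lhs => rw [← stdGaussian_map_reflection hx]
    have hs : Measurable fun G ↦ inner 𝕜 (φ (eval x G)) (eval y G) :=
      (hφ.comp (hm x)).inner (hm y)
    rw [integral_map hR.aemeasurable hs.aestronglyMeasurable]
    congr 1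
    ext G
    have h2 : ∀ z, eval z ((2 : ℝ) • coeval x (eval x G) - G) =
        (2 * inner 𝕜 x z) • eval x G - eval z G := fun z ↦ by
      rw [two_smul, map_sub, map_add, eval_coeval, mul_smul, two_smul]
    rw [h2, h2, inner_self_eq_norm_sq_to_K, hx, inner_sub_right, inner_smul_right]
    have h3 : (2 * (((1 : ℝ) : 𝕜)) ^ 2) • eval x G - eval x G = eval x G := by
      simp [two_smul]
    rw [h3]
  rw [integral_sub ((integrable_inner_eval x hφ hb).const_mul _) (integrable_inner_eval y hφ hb),
    integral_const_mul] at h1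
  have h4 : ∫ h, inner 𝕜 (φ h) h ∂(stdGaussian (EuclideanSpace 𝕜 (Fin d))) =
      ∫ G, inner 𝕜 (φ (eval x G)) (eval x G) ∂(stdGaussian (ColumnMatrix 𝕜 d p)) := by
    have hs : Measurable fun h ↦ inner 𝕜 (φ h) h := hφ.inner measurable_id
    rw [← stdGaussian_map_eval hx, integral_map (hm x).aemeasurable hs.aestronglyMeasurable]
  rw [h4]
  apply mul_left_cancel₀ (two_ne_zero (α := 𝕜))
  linear_combination h1

end ColumnMatrix

end GaussianMatrix

/-! ### Normalization to the unit sphere. -/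

section UnitNormalization

variable {𝕜 : Type*} [RCLike 𝕜] {d : ℕ}

open Classical in
/-- Normalization of vectors, with `0` sent to the unit vector `e`. -/
noncomputable def unitNormalize (e v : EuclideanSpace 𝕜 (Fin d)) : EuclideanSpace 𝕜 (Fin d) :=
  if v = 0 then e else (‖v‖⁻¹ : 𝕜) • v

lemma norm_unitNormalize {e : EuclideanSpace 𝕜 (Fin d)} (he : ‖e‖ = 1)
    (v : EuclideanSpace 𝕜 (Fin d)) : ‖unitNormalize e v‖ = 1 := by
  unfold unitNormalize
  split_ifs with h
  · exact he
  · rw [norm_smul, norm_inv, RCLike.norm_ofReal, abs_norm, inv_mul_cancel₀ (norm_ne_zero_iff.2 h)]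

lemma inner_unitNormalize (e v : EuclideanSpace 𝕜 (Fin d)) :
    inner 𝕜 (unitNormalize e v) v = (‖v‖ : 𝕜) := by
  unfold unitNormalize
  split_ifs with h
  · simp [h]
  · have : (‖v‖ : 𝕜) ≠ 0 := by simpa using h
    rw [inner_smul_left, inner_self_eq_norm_sq_to_K]
    simp only [map_inv₀, RCLike.conj_ofReal]
    field_simp

lemma measurable_unitNormalize (e : EuclideanSpace 𝕜 (Fin d)) : Measurable (unitNormalize e) := by
  unfold unitNormalize
  refine Measurable.ite (measurableSet_singleton 0) measurable_const ?_
  have : Measurable fun v : EuclideanSpace 𝕜 (Fin d) ↦ (‖v‖⁻¹ : 𝕜) :=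
    (RCLike.measurable_ofReal.comp measurable_norm).inv
  exact this.smul measurable_id

end UnitNormalization

/-! ### Upper bound by Gaussian rounding. -/

section GammaSeminorm

variable {𝕜 : Type*} [RCLike 𝕜] {n d p : ℕ}

lemma norm_sum_mul_inner_le_gammaSeminorm (A : Matrix (Fin n) (Fin n) 𝕜)
    {x : Fin n → EuclideanSpace 𝕜 (Fin d)} (hx : ∀ i, ‖x i‖ = 1) :
    ‖∑ i, ∑ j, A i j * inner 𝕜 (x i) (x j)‖ ≤ gammaSeminorm d A := by
  refine le_csSup ⟨∑ i, ∑ j, ‖A i j‖, ?_⟩ ⟨x, hx, rfl⟩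
  rintro _ ⟨y, hy, rfl⟩
  refine (norm_sum_le _ _).trans (Finset.sum_le_sum fun i _ ↦ (norm_sum_le _ _).trans
    (Finset.sum_le_sum fun j _ ↦ ?_))
  rw [norm_mul]
  refine mul_le_of_le_one_right (norm_nonneg _) ((norm_inner_le_norm _ _).trans ?_)
  rw [hy, hy, one_mul]

lemma gammaSeminorm_nonneg (A : Matrix (Fin n) (Fin n) 𝕜) : 0 ≤ gammaSeminorm d A := by
  refine Real.sSup_nonneg ?_
  rintro _ ⟨x, _, rfl⟩
  exact norm_nonneg _

lemma gammaSeminorm_le {A : Matrix (Fin n) (Fin n) 𝕜} {B : ℝ} (hB : 0 ≤ B)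
    (h : ∀ x : Fin n → EuclideanSpace 𝕜 (Fin d), (∀ i, ‖x i‖ = 1) →
      ‖∑ i, ∑ j, A i j * inner 𝕜 (x i) (x j)‖ ≤ B) : gammaSeminorm d A ≤ B := by
  refine Real.sSup_le ?_ hB
  rintro _ ⟨x, hx, rfl⟩
  exact h x hx

open scoped ComplexOrder in
-- The sum splits over the coordinates of the vectors into values of the quadratic form of A.
lemma Matrix.PosSemidef.sum_mul_inner_nonneg {A : Matrix (Fin n) (Fin n) 𝕜} (hA : A.PosSemidef)
    (v : Fin n → EuclideanSpace 𝕜 (Fin d)) :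
    0 ≤ ∑ i, ∑ j, A i j * inner 𝕜 (v i) (v j) := by
  have h : ∑ i, ∑ j, A i j * inner 𝕜 (v i) (v j) =
      ∑ l, star (fun i ↦ v i l) ⬝ᵥ A.mulVec (fun i ↦ v i l) := by
    simp only [PiLp.inner_apply, dotProduct, Matrix.mulVec, Finset.mul_sum]
    symm
    rw [Finset.sum_comm]
    refine Finset.sum_congr rfl fun i _ ↦ ?_
    rw [Finset.sum_comm]
    refine Finset.sum_congr rfl fun j _ ↦ Finset.sum_congr rfl fun l _ ↦ ?_
    simp only [RCLike.inner_apply, Pi.star_apply, RCLike.star_def]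
    ring
  rw [h]
  exact Finset.sum_nonneg fun l _ ↦ hA.dotProduct_mulVec_nonneg _

open scoped ComplexOrder in
lemma Matrix.PosSemidef.re_sum_mul_inner {A : Matrix (Fin n) (Fin n) 𝕜} (hA : A.PosSemidef)
    (v : Fin n → EuclideanSpace 𝕜 (Fin d)) :
    RCLike.re (∑ i, ∑ j, A i j * inner 𝕜 (v i) (v j)) =
      ‖∑ i, ∑ j, A i j * inner 𝕜 (v i) (v j)‖ := by
  have h := congrArg RCLike.re (RCLike.norm_of_nonneg' (hA.sum_mul_inner_nonneg v))
  rw [RCLike.ofReal_re] at h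
  exact h.symm

/-- The function `v ↦ v / ‖v‖ - α v` for the `α` that makes it orthogonal to linear functions of a
Gaussian vector. -/
noncomputable def sphereResidual (e v : EuclideanSpace 𝕜 (Fin d)) : EuclideanSpace 𝕜 (Fin d) :=
  unitNormalize e v - ((gaussMeanNorm (Module.finrank ℝ 𝕜 * d) /
    ((Module.finrank ℝ 𝕜 * d : ℕ) : ℝ) : ℝ) : 𝕜) • v

lemma measurable_inner_comp_eval {φ χ : EuclideanSpace 𝕜 (Fin d) → EuclideanSpace 𝕜 (Fin d)}
    (hφ : Measurable φ) (hχ : Measurable χ) (x y : EuclideanSpace 𝕜 (Fin p)) :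
    Measurable fun G : ColumnMatrix 𝕜 d p ↦
      inner 𝕜 (φ (ColumnMatrix.eval x G)) (χ (ColumnMatrix.eval y G)) :=
  (hφ.comp (ColumnMatrix.eval x).continuous.measurable).inner
    (hχ.comp (ColumnMatrix.eval y).continuous.measurable)

lemma integrable_inner_unitNormalize {e : EuclideanSpace 𝕜 (Fin d)} (he : ‖e‖ = 1)
    (x y : EuclideanSpace 𝕜 (Fin p)) :
    Integrable (fun G ↦ inner 𝕜 (unitNormalize e (ColumnMatrix.eval x G))
      (unitNormalize e (ColumnMatrix.eval y G))) (stdGaussian (ColumnMatrix 𝕜 d p)) := by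
  refine (integrable_const (1 : ℝ)).mono' (measurable_inner_comp_eval (measurable_unitNormalize e)
    (measurable_unitNormalize e) x y).aestronglyMeasurable (ae_of_all _ fun G ↦ ?_)
  refine (norm_inner_le_norm _ _).trans ?_
  rw [norm_unitNormalize he, norm_unitNormalize he, one_mul]

lemma integrable_integral_inner_unitNormalize_eval (hd : 1 ≤ d) {e : EuclideanSpace 𝕜 (Fin d)}
    (he : ‖e‖ = 1) {x : EuclideanSpace 𝕜 (Fin p)} (hx : ‖x‖ = 1) (y : EuclideanSpace 𝕜 (Fin p)) :
    Integrable (fun G ↦ inner 𝕜 (unitNormalize e (ColumnMatrix.eval x G))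
      (ColumnMatrix.eval y G)) (stdGaussian (ColumnMatrix 𝕜 d p)) ∧
    ∫ G, inner 𝕜 (unitNormalize e (ColumnMatrix.eval x G)) (ColumnMatrix.eval y G)
      ∂(stdGaussian (ColumnMatrix 𝕜 d p)) =
      inner 𝕜 x y * (gaussMeanNorm (Module.finrank ℝ 𝕜 * d) : 𝕜) := by
  have hfin := finrank_real_euclideanSpace 𝕜 d
  have hnt : Nontrivial (EuclideanSpace 𝕜 (Fin d)) :=
    Module.nontrivial_of_finrank_pos (R := ℝ) (hfin ▸ Nat.mul_pos Module.finrank_pos hd)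
  have hb : ∀ v, ‖unitNormalize e v‖ ≤ 1 + ‖v‖ := fun v ↦ by
    rw [norm_unitNormalize he]
    linarith [norm_nonneg v]
  refine ⟨ColumnMatrix.integrable_inner_eval y (measurable_unitNormalize e) hb, ?_⟩
  rw [ColumnMatrix.integral_inner_eval hx y (measurable_unitNormalize e) hb]
  simp_rw [inner_unitNormalize]
  rw [integral_ofReal, integral_norm_stdGaussian, hfin]

lemma integrable_integral_eval_inner_unitNormalize (hd : 1 ≤ d) {e : EuclideanSpace 𝕜 (Fin d)}
    (he : ‖e‖ = 1) (x : EuclideanSpace 𝕜 (Fin p)) {y : EuclideanSpace 𝕜 (Fin p)} (hy : ‖y‖ = 1) :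
    Integrable (fun G ↦ inner 𝕜 (ColumnMatrix.eval x G)
      (unitNormalize e (ColumnMatrix.eval y G))) (stdGaussian (ColumnMatrix 𝕜 d p)) ∧
    ∫ G, inner 𝕜 (ColumnMatrix.eval x G) (unitNormalize e (ColumnMatrix.eval y G))
      ∂(stdGaussian (ColumnMatrix 𝕜 d p)) =
      inner 𝕜 x y * (gaussMeanNorm (Module.finrank ℝ 𝕜 * d) : 𝕜) := by
  obtain ⟨hi, h⟩ := integrable_integral_inner_unitNormalize_eval hd he hy x
  have hc : ∀ G : ColumnMatrix 𝕜 d p, inner 𝕜 (ColumnMatrix.eval x G)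
      (unitNormalize e (ColumnMatrix.eval y G)) = (starRingEnd 𝕜)
        (inner 𝕜 (unitNormalize e (ColumnMatrix.eval y G)) (ColumnMatrix.eval x G)) := fun G ↦
    (inner_conj_symm _ _).symm
  simp_rw [hc]
  refine ⟨RCLike.conjCLE.toContinuousLinearMap.integrable_comp hi, ?_⟩
  rw [integral_conj, h, map_mul, inner_conj_symm, RCLike.conj_ofReal]

lemma integrable_integral_inner_eval_eval {x : EuclideanSpace 𝕜 (Fin p)} (hx : ‖x‖ = 1)
    (y : EuclideanSpace 𝕜 (Fin p)) :
    Integrable (fun G ↦ inner 𝕜 (ColumnMatrix.eval x G) (ColumnMatrix.eval y G))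
      (stdGaussian (ColumnMatrix 𝕜 d p)) ∧
    ∫ G, inner 𝕜 (ColumnMatrix.eval x G) (ColumnMatrix.eval y G)
      ∂(stdGaussian (ColumnMatrix 𝕜 d p)) =
      inner 𝕜 x y * (((Module.finrank ℝ 𝕜 * d : ℕ) : ℝ) : 𝕜) := by
  have hb : ∀ v : EuclideanSpace 𝕜 (Fin d), ‖id v‖ ≤ 1 + ‖v‖ := fun v ↦ by simp
  refine ⟨ColumnMatrix.integrable_inner_eval (φ := id) y measurable_id hb, ?_⟩
  have h := ColumnMatrix.integral_inner_eval (φ := id) hx y measurable_id hb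
  simp only [id] at h
  rw [h]
  simp_rw [inner_self_eq_norm_sq_to_K, ← RCLike.ofReal_pow]
  rw [integral_ofReal, integral_norm_sq_stdGaussian, finrank_real_euclideanSpace]

/-- Every term of the expansion except the first is linear in at least one of G x, G y, so its mean
is a multiple of ⟨x, y⟩. -/
lemma integrable_integral_inner_sphereResidual (hd : 1 ≤ d) {e : EuclideanSpace 𝕜 (Fin d)}
    (he : ‖e‖ = 1) {x y : EuclideanSpace 𝕜 (Fin p)} (hx : ‖x‖ = 1) (hy : ‖y‖ = 1) :
    Integrable (fun G ↦ inner 𝕜 (sphereResidual e (ColumnMatrix.eval x G))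
      (sphereResidual e (ColumnMatrix.eval y G))) (stdGaussian (ColumnMatrix 𝕜 d p)) ∧
    ∫ G, inner 𝕜 (sphereResidual e (ColumnMatrix.eval x G))
      (sphereResidual e (ColumnMatrix.eval y G)) ∂(stdGaussian (ColumnMatrix 𝕜 d p)) =
      (∫ G, inner 𝕜 (unitNormalize e (ColumnMatrix.eval x G))
        (unitNormalize e (ColumnMatrix.eval y G)) ∂(stdGaussian (ColumnMatrix 𝕜 d p))) -
      (gaussRatio (Module.finrank ℝ 𝕜 * d) : 𝕜) * inner 𝕜 x y := by
  have i0 := integrable_inner_unitNormalize (p := p) he x y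
  obtain ⟨i1, h1⟩ := integrable_integral_inner_unitNormalize_eval hd he hx y
  obtain ⟨i2, h2⟩ := integrable_integral_eval_inner_unitNormalize hd he x hy
  obtain ⟨i3, h3⟩ := integrable_integral_inner_eval_eval (d := d) hx y
  have hN : ((Module.finrank ℝ 𝕜 * d : ℕ) : ℝ) ≠ 0 :=
    Nat.cast_ne_zero.2 (Nat.mul_pos Module.finrank_pos hd).ne'
  simp only [sphereResidual, gaussRatio, inner_sub_left, inner_sub_right, inner_smul_left,
    inner_smul_right, RCLike.conj_ofReal]
  generalize ((Module.finrank ℝ 𝕜 * d : ℕ) : ℝ) = N at *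
  generalize gaussMeanNorm (Module.finrank ℝ 𝕜 * d) = μ at *
  set α : ℝ := μ / N with hα
  have i4 := i0.sub (i2.const_mul (α : 𝕜))
  have i5 := (i1.const_mul (α : 𝕜)).sub ((i3.const_mul (α : 𝕜)).const_mul (α : 𝕜))
  refine ⟨?_, ?_⟩
  · refine (i4.sub i5).congr (ae_of_all _ fun G ↦ ?_)
    simp only [Pi.sub_apply]
    ring
  -- Two cross terms α μ minus the quadratic term α² N; α = μ / N maximizes this.
  · have hαμ : μ ^ 2 / N = 2 * α * μ - α ^ 2 * N := by
      rw [hα]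
      field_simp
      ring
    calc _ = ∫ G, ((inner 𝕜 (unitNormalize e (ColumnMatrix.eval x G))
              (unitNormalize e (ColumnMatrix.eval y G)) -
            α * inner 𝕜 (ColumnMatrix.eval x G) (unitNormalize e (ColumnMatrix.eval y G))) -
            (α * inner 𝕜 (unitNormalize e (ColumnMatrix.eval x G)) (ColumnMatrix.eval y G) -
              α * (α * inner 𝕜 (ColumnMatrix.eval x G) (ColumnMatrix.eval y G))))
              ∂(stdGaussian (ColumnMatrix 𝕜 d p)) := by
          congr 1
          ext G
          ring
      _ = _ := by
          refine (integral_sub i4 i5).trans ?_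
          simp only [Pi.sub_apply]
          rw [integral_sub i0 (i2.const_mul _),
            integral_sub (i1.const_mul _) ((i3.const_mul _).const_mul _)]
          simp_rw [integral_const_mul]
          rw [h1, h2, h3, hαμ]
          push_cast
          ring

lemma integrable_integral_sum_mul {Ω : Type*} [MeasurableSpace Ω] {P : Measure Ω}
    (A : Matrix (Fin n) (Fin n) 𝕜) {f : Fin n → Fin n → Ω → 𝕜} (hf : ∀ i j, Integrable (f i j) P) :
    Integrable (fun ω ↦ ∑ i, ∑ j, A i j * f i j ω) P ∧
    ∫ ω, ∑ i, ∑ j, A i j * f i j ω ∂P = ∑ i, ∑ j, A i j * ∫ ω, f i j ω ∂P := by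
  refine ⟨integrable_finsetSum _ fun i _ ↦ integrable_finsetSum _ fun j _ ↦ (hf i j).const_mul _,
    ?_⟩
  refine (integral_finsetSum (f := fun i ω ↦ ∑ j, A i j * f i j ω) _ fun i _ ↦
    integrable_finsetSum _ fun j _ ↦ (hf i j).const_mul _).trans ?_
  refine Finset.sum_congr rfl fun i _ ↦ ?_
  refine (integral_finsetSum (f := fun j ω ↦ A i j * f i j ω) _ fun j _ ↦
    (hf i j).const_mul _).trans ?_
  exact Finset.sum_congr rfl fun j _ ↦ integral_const_mul _ _

open scoped ComplexOrder in
/-- Gaussian rounding of a vector configuration to the unit sphere of `𝕜 ^ d`. -/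
theorem gaussRatio_mul_norm_sum_le (hd : 1 ≤ d) {A : Matrix (Fin n) (Fin n) 𝕜}
    (hA : A.PosSemidef) {x : Fin n → EuclideanSpace 𝕜 (Fin p)} (hx : ∀ i, ‖x i‖ = 1) :
    gaussRatio (Module.finrank ℝ 𝕜 * d) * ‖∑ i, ∑ j, A i j * inner 𝕜 (x i) (x j)‖ ≤
      gammaSeminorm d A := by
  let e : EuclideanSpace 𝕜 (Fin d) := EuclideanSpace.single ⟨0, hd⟩ 1
  have he : ‖e‖ = 1 := by simp [e]
  have hres := fun i j ↦ integrable_integral_inner_sphereResidual hd he (hx i) (hx j)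
  obtain ⟨iψ, eψ⟩ := integrable_integral_sum_mul A fun i j ↦ (hres i j).1
  obtain ⟨-, eφ⟩ := integrable_integral_sum_mul A fun i j ↦
    integrable_inner_unitNormalize (p := p) he (x i) (x j)
  have hpos : 0 ≤ RCLike.re (∫ G, ∑ i, ∑ j, A i j *
      inner 𝕜 (sphereResidual e (ColumnMatrix.eval (x i) G))
        (sphereResidual e (ColumnMatrix.eval (x j) G)) ∂(stdGaussian (ColumnMatrix 𝕜 d p))) := by
    rw [← integral_re iψ]
    refine integral_nonneg fun G ↦ ?_
    have h := hA.re_sum_mul_inner fun i ↦ sphereResidual e (ColumnMatrix.eval (x i) G)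
    exact (norm_nonneg _).trans h.ge
  have hle : RCLike.re (∫ G, ∑ i, ∑ j, A i j *
      inner 𝕜 (unitNormalize e (ColumnMatrix.eval (x i) G))
        (unitNormalize e (ColumnMatrix.eval (x j) G)) ∂(stdGaussian (ColumnMatrix 𝕜 d p))) ≤
      gammaSeminorm d A := by
    refine (RCLike.re_le_norm _).trans ?_
    have h := norm_integral_le_of_norm_le_const (μ := stdGaussian (ColumnMatrix 𝕜 d p))
      (ae_of_all _ fun G ↦ norm_sum_mul_inner_le_gammaSeminorm A
        (x := fun i ↦ unitNormalize e (ColumnMatrix.eval (x i) G)) fun i ↦ norm_unitNormalize he _)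
    rwa [probReal_univ, mul_one] at h
  have hsplit : ∑ i, ∑ j, A i j * ∫ G, inner 𝕜 (sphereResidual e (ColumnMatrix.eval (x i) G))
        (sphereResidual e (ColumnMatrix.eval (x j) G)) ∂(stdGaussian (ColumnMatrix 𝕜 d p)) =
      (∑ i, ∑ j, A i j * ∫ G, inner 𝕜 (unitNormalize e (ColumnMatrix.eval (x i) G))
        (unitNormalize e (ColumnMatrix.eval (x j) G)) ∂(stdGaussian (ColumnMatrix 𝕜 d p))) -
        (gaussRatio (Module.finrank ℝ 𝕜 * d) : 𝕜) *
          ∑ i, ∑ j, A i j * inner 𝕜 (x i) (x j) := by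
    rw [Finset.mul_sum, ← Finset.sum_sub_distrib]
    refine Finset.sum_congr rfl fun i _ ↦ ?_
    rw [Finset.mul_sum, ← Finset.sum_sub_distrib]
    refine Finset.sum_congr rfl fun j _ ↦ ?_
    rw [(hres i j).2]
    ring
  rw [eψ, hsplit, map_sub, RCLike.re_ofReal_mul, hA.re_sum_mul_inner] at hpos
  rw [eφ] at hle
  linarith

theorem gammaSeminorm_le_of_mem_psdCones (hd : 1 ≤ d) {A : Matrix (Fin n) (Fin n) 𝕜}
    (hA : A ∈ psdCones 𝕜 n) :
    gammaSeminorm p A ≤ (gaussRatio (Module.finrank ℝ 𝕜 * d))⁻¹ * gammaSeminorm d A := by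
  have hρ : 0 < gaussRatio (Module.finrank ℝ 𝕜 * d) :=
    gaussRatio_pos (Nat.mul_pos Module.finrank_pos hd)
  refine gammaSeminorm_le (mul_nonneg (inv_nonneg.2 hρ.le) (gammaSeminorm_nonneg A)) fun x hx ↦ ?_
  rw [inv_mul_eq_div, le_div_iff₀ hρ, mul_comm]
  exact gaussRatio_mul_norm_sum_le hd hA hx

variable (𝕜) in
theorem conicConst_le (hd : 1 ≤ d) :
    conicConst (psdCones 𝕜) d p ≤ ENNReal.ofReal (gaussRatio (Module.finrank ℝ 𝕜 * d))⁻¹ := by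
  refine iSup_le fun n ↦ iSup₂_le fun A hA ↦ ENNReal.div_le_of_le_mul ?_
  rw [← ENNReal.ofReal_mul (inv_nonneg.2 (gaussRatio_pos (Nat.mul_pos Module.finrank_pos hd)).le)]
  exact ENNReal.ofReal_le_ofReal (gammaSeminorm_le_of_mem_psdCones hd hA)

end GammaSeminorm

/-! ### Weighted Gram matrices: their form as a squared Frobenius norm. -/

section WeightedGram

variable {𝕜 : Type*} [RCLike 𝕜] {n d p : ℕ}

/-- The matrix with entries `w i * w j * ⟨u j, u i⟩`. -/
noncomputable def weightedGram (w : Fin n → ℝ) (u : Fin n → EuclideanSpace 𝕜 (Fin p)) :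
    Matrix (Fin n) (Fin n) 𝕜 :=
  Matrix.of fun i j ↦ (w i : 𝕜) * (w j : 𝕜) * inner 𝕜 (u j) (u i)

open scoped ComplexOrder in
lemma weightedGram_mem_psdCones (w : Fin n → ℝ) (u : Fin n → EuclideanSpace 𝕜 (Fin p)) :
    weightedGram w u ∈ psdCones 𝕜 n := by
  let B : Matrix (Fin p) (Fin n) 𝕜 := Matrix.of fun l i ↦ (w i : 𝕜) * (starRingEnd 𝕜) (u i l)
  have h : weightedGram w u = B.conjTranspose * B := by
    ext i j
    simp only [weightedGram, Matrix.mul_apply, Matrix.conjTranspose_apply, B, Matrix.of_apply,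
      PiLp.inner_apply, RCLike.inner_apply, Finset.mul_sum, RCLike.star_def, map_mul,
      RCLike.conj_ofReal, RCLike.conj_conj]
    exact Finset.sum_congr rfl fun l _ ↦ by ring
  change (weightedGram w u).PosSemidef
  rw [h]
  exact Matrix.posSemidef_conjTranspose_mul_self B

/-- The rows of the adjoint of the matrix `∑ i, w i • u i (x i)*`. -/
noncomputable def gramRow (w : Fin n → ℝ) (u : Fin n → EuclideanSpace 𝕜 (Fin p))
    (x : Fin n → EuclideanSpace 𝕜 (Fin d)) (l : Fin d) : EuclideanSpace 𝕜 (Fin p) :=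
  ∑ i, ((w i : 𝕜) * (starRingEnd 𝕜) (x i l)) • u i

lemma sum_weightedGram_mul_inner (w : Fin n → ℝ) (u : Fin n → EuclideanSpace 𝕜 (Fin p))
    (x : Fin n → EuclideanSpace 𝕜 (Fin d)) :
    ∑ i, ∑ j, weightedGram w u i j * inner 𝕜 (x i) (x j) =
      ((∑ l, ‖gramRow w u x l‖ ^ 2 : ℝ) : 𝕜) := by
  push_cast
  simp_rw [← inner_self_eq_norm_sq_to_K, gramRow, sum_inner, inner_sum, inner_smul_left,
    inner_smul_right]
  symm
  rw [Finset.sum_comm, Finset.sum_congr rfl fun i _ ↦ Finset.sum_comm, Finset.sum_comm]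
  refine Finset.sum_congr rfl fun i _ ↦ Finset.sum_congr rfl fun j _ ↦ ?_
  simp only [weightedGram, Matrix.of_apply]
  rw [PiLp.inner_apply (x i), Finset.mul_sum]
  refine Finset.sum_congr rfl fun l _ ↦ ?_
  simp only [RCLike.inner_apply, map_mul, RCLike.conj_ofReal, RCLike.conj_conj]
  ring

lemma norm_sum_weightedGram_mul_inner (w : Fin n → ℝ) (u : Fin n → EuclideanSpace 𝕜 (Fin p))
    (x : Fin n → EuclideanSpace 𝕜 (Fin d)) :
    ‖∑ i, ∑ j, weightedGram w u i j * inner 𝕜 (x i) (x j)‖ = ∑ l, ‖gramRow w u x l‖ ^ 2 := by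
  rw [sum_weightedGram_mul_inner, RCLike.norm_ofReal, abs_of_nonneg (by positivity)]

lemma sum_gramRow_apply_self (w : Fin n → ℝ) (u x : Fin n → EuclideanSpace 𝕜 (Fin p)) :
    ∑ k, gramRow w u x k k = ∑ i, (w i : 𝕜) * inner 𝕜 (x i) (u i) := by
  simp only [gramRow, WithLp.ofLp_sum, WithLp.ofLp_smul, Finset.sum_apply, Pi.smul_apply,
    smul_eq_mul]
  rw [Finset.sum_comm]
  refine Finset.sum_congr rfl fun i _ ↦ ?_
  rw [PiLp.inner_apply, Finset.mul_sum]
  exact Finset.sum_congr rfl fun k _ ↦ by rw [RCLike.inner_apply]; ring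

/-- Test with x_i = u_i / ‖u_i‖: the trace of M = ∑ w_i u_i x_i* is then ∑ w_i ‖u_i‖, and
Cauchy–Schwarz on the diagonal gives |tr M|² ≤ p ‖M‖². -/
lemma sq_sum_mul_norm_div_le_gammaSeminorm (hp : 1 ≤ p) (w : Fin n → ℝ)
    (u : Fin n → EuclideanSpace 𝕜 (Fin p)) :
    (∑ i, w i * ‖u i‖) ^ 2 / p ≤ gammaSeminorm p (weightedGram w u) := by
  let e : EuclideanSpace 𝕜 (Fin p) := EuclideanSpace.single ⟨0, hp⟩ 1
  have he : ‖e‖ = 1 := by simp [e]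
  let x : Fin n → EuclideanSpace 𝕜 (Fin p) := fun i ↦ unitNormalize e (u i)
  have hle := norm_sum_mul_inner_le_gammaSeminorm (weightedGram w u) (x := x)
    fun i ↦ norm_unitNormalize he (u i)
  rw [norm_sum_weightedGram_mul_inner] at hle
  refine le_trans ?_ hle
  have htr : |∑ i, w i * ‖u i‖| ≤ ∑ k, ‖gramRow w u x k k‖ := by
    have h := sum_gramRow_apply_self w u x
    simp_rw [x, inner_unitNormalize] at h
    have h2 : ‖∑ k, gramRow w u x k k‖ = |∑ i, w i * ‖u i‖| := by
      rw [h, ← RCLike.norm_ofReal (K := 𝕜)]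
      push_cast
      rfl
    rw [← h2]
    exact norm_sum_le _ _
  have hp' : (0 : ℝ) < p := by exact_mod_cast hp
  rw [div_le_iff₀ hp', mul_comm]
  calc (∑ i, w i * ‖u i‖) ^ 2 = |∑ i, w i * ‖u i‖| ^ 2 := (sq_abs _).symm
    _ ≤ (∑ k, ‖gramRow w u x k k‖) ^ 2 := by gcongr
    _ ≤ p * ∑ k, ‖gramRow w u x k k‖ ^ 2 := by
      simpa using sq_sum_le_card_mul_sum_sq (s := Finset.univ)
        (f := fun k : Fin p ↦ ‖gramRow w u x k k‖)
    _ ≤ _ := by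
      gcongr with k
      exact PiLp.norm_apply_le _ _

/-- The map with rows `m l`. -/
noncomputable def rowMap (m : Fin d → EuclideanSpace 𝕜 (Fin p)) :
    EuclideanSpace 𝕜 (Fin p) →L[ℝ] EuclideanSpace 𝕜 (Fin d) :=
  ((EuclideanSpace.equiv (Fin d) 𝕜).symm.toContinuousLinearMap.comp
    (ContinuousLinearMap.pi fun l ↦ innerSL 𝕜 (m l))).restrictScalars ℝ

lemma rowMap_apply (m : Fin d → EuclideanSpace 𝕜 (Fin p)) (v : EuclideanSpace 𝕜 (Fin p))
    (l : Fin d) : rowMap m v l = inner 𝕜 (m l) v := rfl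

lemma norm_rowMap_sq (m : Fin d → EuclideanSpace 𝕜 (Fin p)) (v : EuclideanSpace 𝕜 (Fin p)) :
    ‖rowMap m v‖ ^ 2 = ∑ l, ‖inner 𝕜 (m l) v‖ ^ 2 := by
  rw [EuclideanSpace.norm_sq_eq]
  rfl

lemma norm_rowMap_le (m : Fin d → EuclideanSpace 𝕜 (Fin p)) (v : EuclideanSpace 𝕜 (Fin p)) :
    ‖rowMap m v‖ ≤ √(∑ l, ‖m l‖ ^ 2) * ‖v‖ := by
  refine le_of_sq_le_sq ?_ (by positivity)
  rw [norm_rowMap_sq, mul_pow, Real.sq_sqrt (by positivity), Finset.sum_mul]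
  gcongr with l
  rw [← mul_pow]
  gcongr
  exact norm_inner_le_norm _ _

lemma integrable_integral_norm_inner_sq (hp : 1 ≤ p) (m : EuclideanSpace 𝕜 (Fin p)) :
    Integrable (fun g ↦ ‖inner 𝕜 m g‖ ^ 2) (stdGaussian (EuclideanSpace 𝕜 (Fin p))) ∧
    ∫ g, ‖inner 𝕜 m g‖ ^ 2 ∂(stdGaussian (EuclideanSpace 𝕜 (Fin p))) =
      Module.finrank ℝ 𝕜 * ‖m‖ ^ 2 := by
  let T : EuclideanSpace 𝕜 (Fin p) →L[ℝ] 𝕜 := (innerSL 𝕜 m).restrictScalars ℝ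
  -- This is the adjoint over ℝ. Summing ‖c • m‖² over a real orthonormal basis of 𝕜 produces the
  -- factor `finrank ℝ 𝕜`.
  have hT : ∀ c : 𝕜, T.adjoint c = c • m := fun c ↦ by
    refine ext_inner_left ℝ fun v ↦ ?_
    rw [ContinuousLinearMap.adjoint_inner_right, EuclideanSpace.real_inner_eq_re_inner,
      inner_smul_right, ← inner_conj_symm v m]
    rfl
  obtain ⟨hi, h⟩ := integral_norm_map_sq_mul_radial (stdOrthonormalBasis ℝ 𝕜) (fun _ ↦ 1)
    measurable_const
    (by simpa using integrable_norm_sq_stdGaussian (E := EuclideanSpace 𝕜 (Fin p))) T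
  have hN : (Module.finrank ℝ (EuclideanSpace 𝕜 (Fin p)) : ℝ) ≠ 0 := by
    rw [finrank_real_euclideanSpace]
    exact Nat.cast_ne_zero.2 (Nat.mul_pos Module.finrank_pos hp).ne'
  simp only [mul_one, integral_norm_sq_stdGaussian, hT, norm_smul, OrthonormalBasis.norm_eq_one,
    one_mul, Finset.sum_const, Finset.card_univ, Fintype.card_fin, nsmul_eq_mul] at h hi
  refine ⟨hi, mul_left_cancel₀ hN (h.trans (mul_comm _ _))⟩

lemma integral_norm_rowMap_le (hd : 1 ≤ d) (hdp : d ≤ p) (m : Fin d → EuclideanSpace 𝕜 (Fin p)) :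
    ∫ g, ‖rowMap m g‖ ∂(stdGaussian (EuclideanSpace 𝕜 (Fin p))) ≤
      √(Module.finrank ℝ 𝕜 * gaussRatio (Module.finrank ℝ 𝕜 * d)) * √(∑ l, ‖m l‖ ^ 2) := by
  have hfd := finrank_real_euclideanSpace 𝕜 d
  have hfp := finrank_real_euclideanSpace 𝕜 p
  have h := integral_norm_map_sq_le (rowMap m) (hfd ▸ Nat.mul_pos Module.finrank_pos hd)
    (by rw [hfd, hfp]; gcongr)
  simp_rw [norm_rowMap_sq] at h
  rw [integral_finsetSum _ fun l _ ↦ (integrable_integral_norm_inner_sq (hd.trans hdp) (m l)).1,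
    hfd] at h
  simp_rw [(integrable_integral_norm_inner_sq (hd.trans hdp) _).2, ← Finset.mul_sum] at h
  have hρ := gaussRatio_pos (Nat.mul_pos (Module.finrank_pos (R := ℝ) (M := 𝕜)) hd)
  refine le_of_sq_le_sq ?_ (by positivity)
  rw [mul_pow, Real.sq_sqrt (by positivity), Real.sq_sqrt (by positivity)]
  linarith

/-- Expanding one factor M in ⟨M, M⟩ gives ‖M‖² = ∑ w_i ⟨x_i, M* u_i⟩, which is bounded termwise. -/
lemma sum_norm_gramRow_sq_le {w : Fin n → ℝ} (hw : ∀ i, 0 ≤ w i)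
    (u : Fin n → EuclideanSpace 𝕜 (Fin p)) {x : Fin n → EuclideanSpace 𝕜 (Fin d)}
    (hx : ∀ i, ‖x i‖ = 1) :
    ∑ l, ‖gramRow w u x l‖ ^ 2 ≤ ∑ i, w i * ‖rowMap (gramRow w u x) (u i)‖ := by
  have h : ((∑ l, ‖gramRow w u x l‖ ^ 2 : ℝ) : 𝕜) =
      ∑ i, (w i : 𝕜) * inner 𝕜 (x i) (rowMap (gramRow w u x) (u i)) := by
    push_cast
    simp_rw [PiLp.inner_apply, RCLike.inner_apply, rowMap_apply, Finset.mul_sum]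
    rw [Finset.sum_comm]
    refine Finset.sum_congr rfl fun l _ ↦ ?_
    rw [← inner_self_eq_norm_sq_to_K]
    conv_lhs =>
      arg 3
      rw [gramRow]
    rw [inner_sum]
    refine Finset.sum_congr rfl fun i _ ↦ ?_
    rw [inner_smul_right]
    ring
  calc _ = ‖((∑ l, ‖gramRow w u x l‖ ^ 2 : ℝ) : 𝕜)‖ := by
        rw [RCLike.norm_ofReal, abs_of_nonneg (by positivity)]
    _ ≤ _ := by
        rw [h]
        refine (norm_sum_le _ _).trans (Finset.sum_le_sum fun i _ ↦ ?_)
        rw [norm_mul, RCLike.norm_ofReal, abs_of_nonneg (hw i)]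
        refine mul_le_mul_of_nonneg_left ((norm_inner_le_norm _ _).trans ?_) (hw i)
        rw [hx, one_mul]

end WeightedGram

/-! ### Discretizing the Gaussian measure uniformly over Lipschitz functions. -/

section Discretization

variable {E : Type*} [NormedAddCommGroup E] [InnerProductSpace ℝ E] [FiniteDimensional ℝ E]
  [MeasurableSpace E] [BorelSpace E]

variable (E) in
/-- Finitely supported approximations of the Gaussian measure in the Wasserstein sense. -/
lemma exists_discretization_stdGaussian {ε : ℝ} (hε : 0 < ε) :
    ∃ (n : ℕ) (w : Fin n → ℝ) (u : Fin n → E), (∀ i, 0 ≤ w i) ∧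
      ∀ (f : E → ℝ) (C : ℝ), 0 ≤ C → (∀ x y, |f x - f y| ≤ C * ‖x - y‖) → f 0 = 0 →
        |∑ i, w i * f (u i) - ∫ x, f x ∂(stdGaussian E)| ≤ C * ε := by
  have hid : MemLp (id : E → E) 1 (stdGaussian E) :=
    memLp_one_iff_integrable.2 IsGaussian.integrable_id
  -- A simple function L¹-close to the identity: its values are the atoms and the measures of its
  -- fibres the weights.
  obtain ⟨s, hs, hsm⟩ := hid.exists_simpleFunc_eLpNorm_sub_lt (by simp)
    (ε := ENNReal.ofReal ε) (by simpa using hε)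
  have hsi : Integrable s (stdGaussian E) := memLp_one_iff_integrable.1 hsm
  have hdi : Integrable (fun x ↦ x - s x) (stdGaussian E) :=
    (IsGaussian.integrable_id (μ := stdGaussian E)).sub hsi
  have hdist : ∫ x, ‖x - s x‖ ∂(stdGaussian E) ≤ ε := by
    rw [integral_norm_eq_lintegral_enorm hdi.1]
    refine ENNReal.toReal_le_of_le_ofReal hε.le ?_
    rw [eLpNorm_one_eq_lintegral_enorm] at hs
    exact hs.le
  let t := s.range.equivFin.symm
  refine ⟨s.range.card, fun i ↦ (stdGaussian E).real (s ⁻¹' {(t i : E)}), fun i ↦ t i,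
    fun i ↦ measureReal_nonneg, fun f C hC hf hf0 ↦ ?_⟩
  have hfc : Continuous f := by
    refine (LipschitzWith.of_dist_le_mul (K := ⟨C, hC⟩) fun x y ↦ ?_).continuous
    rw [Real.dist_eq, dist_eq_norm]
    exact hf x y
  have hfi : ∀ g : E → E, Integrable g (stdGaussian E) →
      Integrable (fun x ↦ f (g x)) (stdGaussian E) := fun g hg ↦ by
    refine (hg.norm.const_mul C).mono' (hfc.comp_aestronglyMeasurable hg.1)
      (ae_of_all _ fun x ↦ ?_)
    simpa [hf0] using hf (g x) 0
  have hsum : ∑ i, (stdGaussian E).real (s ⁻¹' {(t i : E)}) * f (t i) =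
      ∫ x, f (s x) ∂(stdGaussian E) := by
    have h1 := SimpleFunc.integral_eq_integral (s.map f) (hfi s hsi)
    have h2 := SimpleFunc.map_integral s f hsi hf0
    rw [SimpleFunc.coe_map] at h1
    change _ = ∫ x, (f ∘ s) x ∂(stdGaussian E)
    rw [← h1, h2, Equiv.sum_comp t fun y : s.range ↦ (stdGaussian E).real (s ⁻¹' {(y : E)}) * f y,
      Finset.sum_coe_sort s.range fun y ↦ (stdGaussian E).real (s ⁻¹' {y}) * f y]
    rfl
  have hfid : Integrable f (stdGaussian E) := hfi id IsGaussian.integrable_id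
  rw [hsum, ← integral_sub (hfi s hsi) hfid]
  calc _ ≤ ∫ x, |f (s x) - f x| ∂(stdGaussian E) := abs_integral_le_integral_abs
    _ ≤ ∫ x, C * ‖x - s x‖ ∂(stdGaussian E) := by
      refine integral_mono ((hfi s hsi).sub hfid).abs
        (hdi.norm.const_mul C) fun x ↦ ?_
      rw [norm_sub_rev]
      exact hf _ _
    _ ≤ C * ε := by
      rw [integral_const_mul]
      gcongr

end Discretization

/-! ### Lower bound from discretized Gaussian Gram matrices. -/

section LowerBound

variable {𝕜 : Type*} [RCLike 𝕜] {d p : ℕ}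

variable (𝕜) in
lemma exists_psd_gammaSeminorm_bounds (hd : 1 ≤ d) (hdp : d ≤ p) {ε : ℝ} (hε : 0 < ε)
    (hεμ : ε < gaussMeanNorm (Module.finrank ℝ 𝕜 * p)) :
    ∃ (n : ℕ), ∃ A ∈ psdCones 𝕜 n,
      (gaussMeanNorm (Module.finrank ℝ 𝕜 * p) - ε) ^ 2 / p ≤ gammaSeminorm p A ∧
      gammaSeminorm d A ≤
        (√(Module.finrank ℝ 𝕜 * gaussRatio (Module.finrank ℝ 𝕜 * d)) + ε) ^ 2 := by
  have hp := hd.trans hdp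
  have hfin := finrank_real_euclideanSpace 𝕜 p
  have hnt : Nontrivial (EuclideanSpace 𝕜 (Fin p)) :=
    Module.nontrivial_of_finrank_pos (R := ℝ) (hfin ▸ Nat.mul_pos Module.finrank_pos hp)
  obtain ⟨n, w, u, hw, hf⟩ := exists_discretization_stdGaussian (EuclideanSpace 𝕜 (Fin p)) hε
  refine ⟨n, weightedGram w u, weightedGram_mem_psdCones w u, ?_, ?_⟩
  · have h := hf (fun v ↦ ‖v‖) 1 zero_le_one (fun x y ↦ by simpa using abs_norm_sub_norm_le x y)
      norm_zero
    rw [integral_norm_stdGaussian, hfin, one_mul] at h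
    refine le_trans ?_ (sq_sum_mul_norm_div_le_gammaSeminorm hp w u)
    have h1 := (abs_le.1 h).1
    have h2 : 0 ≤ gaussMeanNorm (Module.finrank ℝ 𝕜 * p) - ε := by linarith
    gcongr
    linarith
  · refine gammaSeminorm_le (by positivity) fun x hx ↦ ?_
    rw [norm_sum_weightedGram_mul_inner]
    set m := gramRow w u x
    set h := √(∑ l, ‖m l‖ ^ 2) with hh
    have hsq : h ^ 2 = ∑ l, ‖m l‖ ^ 2 := Real.sq_sqrt (by positivity)
    have hh0 : 0 ≤ h := Real.sqrt_nonneg _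
    -- The matrix m depends on x, so the discretization must not depend on the test function. Its
    -- error h ε scales like the main term, leaving h² ≤ (c + ε) h.
    have h1 := hf (fun v ↦ ‖rowMap m v‖) h hh0 (fun x y ↦ by
      refine (abs_norm_sub_norm_le _ _).trans ?_
      rw [← map_sub]
      exact norm_rowMap_le m _) (by simp)
    have h2 := integral_norm_rowMap_le hd hdp m
    have h3 := sum_norm_gramRow_sq_le hw u hx
    have h4 := (abs_le.1 h1).2
    rw [← hsq] at h3 ⊢
    rw [← hh] at h2
    set c := √(Module.finrank ℝ 𝕜 * gaussRatio (Module.finrank ℝ 𝕜 * d))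
    have hc : 0 ≤ c := Real.sqrt_nonneg _
    have h5 : h * h ≤ (c + ε) * h := by linarith
    rcases hh0.eq_or_lt with h0 | h0
    · rw [← h0, zero_pow two_ne_zero]
      positivity
    · have := le_of_mul_le_mul_right h5 h0
      gcongr

variable (𝕜) in
theorem le_conicConst (hd : 1 ≤ d) (hdp : d ≤ p) :
    ENNReal.ofReal (gaussRatio (Module.finrank ℝ 𝕜 * p) / gaussRatio (Module.finrank ℝ 𝕜 * d)) ≤
      conicConst (psdCones 𝕜) d p := by
  have hp := hd.trans hdp
  have hk : (0 : ℝ) < Module.finrank ℝ 𝕜 := Nat.cast_pos.2 Module.finrank_pos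
  have hp' : (0 : ℝ) < p := Nat.cast_pos.2 hp
  have hμ := gaussMeanNorm_pos (Nat.mul_pos (Module.finrank_pos (R := ℝ) (M := 𝕜)) hp)
  have hρ := gaussRatio_pos (Nat.mul_pos (Module.finrank_pos (R := ℝ) (M := 𝕜)) hd)
  set μ := gaussMeanNorm (Module.finrank ℝ 𝕜 * p) with hμdef
  set c := √(Module.finrank ℝ 𝕜 * gaussRatio (Module.finrank ℝ 𝕜 * d)) with hcdef
  have hc : 0 < c := by positivity
  have hlim : Tendsto (fun ε : ℝ ↦ ENNReal.ofReal ((μ - ε) ^ 2 / p / (c + ε) ^ 2)) (𝓝[>] 0)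
      (𝓝 (ENNReal.ofReal ((μ - 0) ^ 2 / p / (c + 0) ^ 2))) := by
    refine ENNReal.tendsto_ofReal (Tendsto.mono_left ?_ nhdsWithin_le_nhds)
    refine ContinuousAt.tendsto (f := fun ε : ℝ ↦ (μ - ε) ^ 2 / p / (c + ε) ^ 2) ?_
    refine ContinuousAt.div (by fun_prop) (by fun_prop) (by positivity)
  -- Since μ² / p = k ρ_{kp} and c² = k ρ_{kd} with k = `finrank ℝ 𝕜`, the factor k cancels.
  have hval : (μ - 0) ^ 2 / p / (c + 0) ^ 2 =
      gaussRatio (Module.finrank ℝ 𝕜 * p) / gaussRatio (Module.finrank ℝ 𝕜 * d) := by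
    rw [sub_zero, add_zero, hcdef, Real.sq_sqrt (by positivity), gaussRatio.eq_def (_ * p), ← hμdef]
    push_cast
    field_simp
  rw [← hval]
  refine le_of_tendsto hlim ?_
  filter_upwards [Ioo_mem_nhdsGT hμ] with ε hε
  obtain ⟨n, A, hA, h1, h2⟩ := exists_psd_gammaSeminorm_bounds 𝕜 hd hdp hε.1 hε.2
  have hcε : 0 < c + ε := add_pos hc hε.1
  rw [ENNReal.ofReal_div_of_pos (by positivity)]
  refine (ENNReal.div_le_div (ENNReal.ofReal_le_ofReal h1) (ENNReal.ofReal_le_ofReal h2)).trans ?_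
  exact le_iSup_of_le n (le_iSup₂_of_le A hA le_rfl)

end LowerBound

/-! ### Gamma function formulas, asymptotics and the final limits. -/

section GaussRatio

lemma gaussRatio_eq (N : ℕ) : gaussRatio N =
    2 * Real.Gamma (((N : ℝ) + 1) / 2) ^ 2 / (N * Real.Gamma ((N : ℝ) / 2) ^ 2) := by
  rw [gaussRatio, gaussMeanNorm, div_pow, mul_pow, Real.sq_sqrt (by norm_num), div_div, mul_comm
    (Real.Gamma _ ^ 2) (N : ℝ)]

lemma inv_gaussRatio_eq (N : ℕ) : (gaussRatio N)⁻¹ =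
    N * Real.Gamma ((N : ℝ) / 2) ^ 2 / (2 * Real.Gamma (((N : ℝ) + 1) / 2) ^ 2) := by
  rw [gaussRatio_eq, inv_div]

lemma gaussRatio_two_mul_eq (d : ℕ) : gaussRatio (2 * d) =
    Real.Gamma ((2 * (d : ℝ) + 1) / 2) ^ 2 / (d * Real.Gamma (d : ℝ) ^ 2) := by
  rw [gaussRatio_eq]
  push_cast
  rw [mul_div_cancel_left₀ _ two_ne_zero, mul_assoc, mul_div_mul_left _ _ two_ne_zero]

/-- Log-convexity of Gamma at the midpoint of x and x + 1. -/
lemma Real.Gamma_add_half_sq_le {x : ℝ} (hx : 0 < x) :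
    Real.Gamma (x + 1 / 2) ^ 2 ≤ x * Real.Gamma x ^ 2 := by
  have h := Real.Gamma_mul_add_mul_le_rpow_Gamma_mul_rpow_Gamma hx (by linarith : 0 < x + 1)
    (by norm_num : (0 : ℝ) < 1 / 2) (by norm_num : (0 : ℝ) < 1 / 2) (by norm_num)
  have hG := Real.Gamma_pos_of_pos hx
  rw [show 1 / 2 * x + 1 / 2 * (x + 1) = x + 1 / 2 by ring, ← Real.sqrt_eq_rpow,
    ← Real.sqrt_eq_rpow, Real.Gamma_add_one hx.ne', ← Real.sqrt_mul hG.le] at h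
  calc Real.Gamma (x + 1 / 2) ^ 2 ≤ √(Real.Gamma x * (x * Real.Gamma x)) ^ 2 := by
        have := Real.Gamma_pos_of_pos (by linarith : 0 < x + 1 / 2)
        gcongr
    _ = x * Real.Gamma x ^ 2 := by
        rw [Real.sq_sqrt (by positivity)]
        ring

lemma gaussRatio_le_one {N : ℕ} (hN : 0 < N) : gaussRatio N ≤ 1 := by
  have hN' : (0 : ℝ) < N := Nat.cast_pos.2 hN
  have h := Real.Gamma_add_half_sq_le (x := (N : ℝ) / 2) (by positivity)
  have hG : 0 < Real.Gamma ((N : ℝ) / 2) := Real.Gamma_pos_of_pos (by positivity)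
  rw [gaussRatio_eq, div_le_one (by positivity), add_div]
  linarith

lemma one_sub_inv_le_gaussRatio {N : ℕ} (hN : 1 < N) : 1 - 1 / (N : ℝ) ≤ gaussRatio N := by
  have hN' : (1 : ℝ) < N := by exact_mod_cast hN
  -- Shifting the midpoint inequality down by 1/2 puts Γ(N/2) on its smaller side, which bounds the
  -- ratio from below.
  have hx : 0 < ((N : ℝ) - 1) / 2 := by linarith
  have h := Real.Gamma_add_half_sq_le hx
  have hG : 0 < Real.Gamma ((N : ℝ) / 2) := Real.Gamma_pos_of_pos (by positivity)
  have h1 := Real.Gamma_add_one hx.ne'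
  rw [show ((N : ℝ) - 1) / 2 + 1 = ((N : ℝ) + 1) / 2 by ring] at h1
  rw [show ((N : ℝ) - 1) / 2 + 1 / 2 = (N : ℝ) / 2 by ring] at h
  rw [gaussRatio_eq, le_div_iff₀ (by positivity), h1]
  calc (1 - 1 / (N : ℝ)) * (N * Real.Gamma ((N : ℝ) / 2) ^ 2)
      = (N - 1) * Real.Gamma ((N : ℝ) / 2) ^ 2 := by field_simp
    _ ≤ (N - 1) * (((N : ℝ) - 1) / 2 * Real.Gamma (((N : ℝ) - 1) / 2) ^ 2) := by
        gcongr
    _ = _ := by ring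

lemma tendsto_gaussRatio : Tendsto gaussRatio atTop (𝓝 1) := by
  have h : Tendsto (fun N : ℕ ↦ 1 - 1 / (N : ℝ)) atTop (𝓝 1) := by
    simpa using tendsto_one_div_atTop_nhds_zero_nat.const_sub (1 : ℝ)
  refine tendsto_of_tendsto_of_tendsto_of_le_of_le' h tendsto_const_nhds ?_ ?_
  · filter_upwards [eventually_gt_atTop 1] with N hN using one_sub_inv_le_gaussRatio hN
  · filter_upwards [eventually_gt_atTop 0] with N hN using gaussRatio_le_one hN

lemma inv_gaussRatio_one : (gaussRatio 1)⁻¹ = Real.pi / 2 := by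
  rw [inv_gaussRatio_eq]
  norm_num [Real.Gamma_one_half_eq, Real.sq_sqrt Real.pi_pos.le]

lemma inv_gaussRatio_two : (gaussRatio 2)⁻¹ = 4 / Real.pi := by
  have h : Real.Gamma (3 / 2) = 1 / 2 * √Real.pi := by
    rw [show (3 / 2 : ℝ) = 1 / 2 + 1 by norm_num, Real.Gamma_add_one (by norm_num),
      Real.Gamma_one_half_eq]
  rw [inv_gaussRatio_eq]
  norm_num [h, mul_pow, Real.sq_sqrt Real.pi_pos.le]
  field_simp

theorem tendsto_conicConst (𝕜 : Type*) [RCLike 𝕜] {d : ℕ} (hd : 1 ≤ d) :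
    Tendsto (fun p : ℕ ↦ conicConst (psdCones 𝕜) d p) atTop
      (𝓝 (ENNReal.ofReal (gaussRatio (Module.finrank ℝ 𝕜 * d))⁻¹)) := by
  have hk : 0 < Module.finrank ℝ 𝕜 := Module.finrank_pos
  have h : Tendsto (fun p : ℕ ↦ ENNReal.ofReal (gaussRatio (Module.finrank ℝ 𝕜 * p) /
      gaussRatio (Module.finrank ℝ 𝕜 * d))) atTop
      (𝓝 (ENNReal.ofReal (1 / gaussRatio (Module.finrank ℝ 𝕜 * d)))) :=
    ENNReal.tendsto_ofReal
      ((tendsto_gaussRatio.comp (tendsto_id.const_mul_atTop' hk)).div_const _)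
  rw [one_div] at h
  refine tendsto_of_tendsto_of_tendsto_of_le_of_le' h tendsto_const_nhds ?_
    (Eventually.of_forall fun p ↦ conicConst_le 𝕜 hd)
  filter_upwards [eventually_ge_atTop d] with p hp using le_conicConst 𝕜 hd hp

end GaussRatio

theorem proposition5p6 :
    -- lower bounds for finite `p`
    (∀ d p : ℕ, 1 ≤ d → d ≤ p →
      ENNReal.ofReal ((d : ℝ) / (p : ℝ) *
          (Real.Gamma (((p : ℝ) + 1) / 2) * Real.Gamma ((d : ℝ) / 2) /
            (Real.Gamma ((p : ℝ) / 2) * Real.Gamma (((d : ℝ) + 1) / 2))) ^ 2)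
        ≤ conicConst (psdCones ℝ) d p ∧
      ENNReal.ofReal ((d : ℝ) / (p : ℝ) *
          (Real.Gamma ((2 * (p : ℝ) + 1) / 2) * Real.Gamma (d : ℝ) /
            (Real.Gamma (p : ℝ) * Real.Gamma ((2 * (d : ℝ) + 1) / 2))) ^ 2)
        ≤ conicConst (psdCones ℂ) d p) ∧
    -- the limits `K_{C,d,∞}` of `K_{C,d,p}` as `p → ∞` exist and have the stated values
    (∀ d : ℕ, 1 ≤ d →
      Tendsto (fun p : ℕ => conicConst (psdCones ℝ) d p) atTop
        (𝓝 (ENNReal.ofReal ((d : ℝ) * Real.Gamma ((d : ℝ) / 2) ^ 2 /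
          (2 * Real.Gamma (((d : ℝ) + 1) / 2) ^ 2)))) ∧
      Tendsto (fun p : ℕ => conicConst (psdCones ℂ) d p) atTop
        (𝓝 (ENNReal.ofReal ((d : ℝ) * Real.Gamma (d : ℝ) ^ 2 /
          Real.Gamma ((2 * (d : ℝ) + 1) / 2) ^ 2)))) ∧
    -- the resulting inequalities between the `γ`- and the `(γ, d)`-seminorm
    (∀ d : ℕ, 1 ≤ d → ∀ n : ℕ,
      (∀ A ∈ psdCones ℝ n, gammaSeminormFull A ≤
        (d : ℝ) * Real.Gamma ((d : ℝ) / 2) ^ 2 / (2 * Real.Gamma (((d : ℝ) + 1) / 2) ^ 2) *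
          gammaSeminorm d A) ∧
      (∀ A ∈ psdCones ℂ n, gammaSeminormFull A ≤
        (d : ℝ) * Real.Gamma (d : ℝ) ^ 2 / Real.Gamma ((2 * (d : ℝ) + 1) / 2) ^ 2 *
          gammaSeminorm d A)) ∧
    -- the case `d = 1`: the sharp constants `π / 2` and `4 / π`
    (Tendsto (fun p : ℕ => conicConst (psdCones ℝ) 1 p) atTop
        (𝓝 (ENNReal.ofReal (Real.pi / 2))) ∧
      Tendsto (fun p : ℕ => conicConst (psdCones ℂ) 1 p) atTop
        (𝓝 (ENNReal.ofReal (4 / Real.pi))) ∧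
      ∀ n : ℕ,
        (∀ A ∈ psdCones ℝ n, gammaSeminormFull A ≤ Real.pi / 2 * gammaSeminorm 1 A) ∧
        (∀ A ∈ psdCones ℂ n, gammaSeminormFull A ≤ 4 / Real.pi * gammaSeminorm 1 A)) := by
  have hR : Module.finrank ℝ ℝ = 1 := Module.finrank_self ℝ
  have hC : Module.finrank ℝ ℂ = 2 := Complex.finrank_real_complex
  have hRd : ∀ d : ℕ, (d : ℝ) * Real.Gamma ((d : ℝ) / 2) ^ 2 /
      (2 * Real.Gamma (((d : ℝ) + 1) / 2) ^ 2) = (gaussRatio (Module.finrank ℝ ℝ * d))⁻¹ :=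
    fun d ↦ by rw [hR, one_mul, inv_gaussRatio_eq]
  have hCd : ∀ d : ℕ, (d : ℝ) * Real.Gamma (d : ℝ) ^ 2 /
      Real.Gamma ((2 * (d : ℝ) + 1) / 2) ^ 2 = (gaussRatio (Module.finrank ℝ ℂ * d))⁻¹ :=
    fun d ↦ by rw [hC, gaussRatio_two_mul_eq, inv_div]
  have hR1 : Real.pi / 2 = (gaussRatio (Module.finrank ℝ ℝ * 1))⁻¹ := by
    rw [hR, ← inv_gaussRatio_one]
  have hC1 : 4 / Real.pi = (gaussRatio (Module.finrank ℝ ℂ * 1))⁻¹ := by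
    rw [hC, ← inv_gaussRatio_two]
  simp_rw [hRd, hCd]
  rw [hR1, hC1]
  refine ⟨fun d p hd hdp ↦ ⟨?_, ?_⟩, fun d hd ↦ ⟨tendsto_conicConst ℝ hd, tendsto_conicConst ℂ hd⟩,
    fun d hd n ↦ ⟨fun A hA ↦ gammaSeminorm_le_of_mem_psdCones hd hA,
      fun A hA ↦ gammaSeminorm_le_of_mem_psdCones hd hA⟩,
    tendsto_conicConst ℝ le_rfl, tendsto_conicConst ℂ le_rfl,
    fun n ↦ ⟨fun A hA ↦ gammaSeminorm_le_of_mem_psdCones le_rfl hA,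
      fun A hA ↦ gammaSeminorm_le_of_mem_psdCones le_rfl hA⟩⟩
  · refine le_of_eq_of_le (congrArg ENNReal.ofReal ?_) (le_conicConst ℝ hd hdp)
    rw [hR, one_mul, one_mul, gaussRatio_eq, gaussRatio_eq]
    field_simp
  · refine le_of_eq_of_le (congrArg ENNReal.ofReal ?_) (le_conicConst ℂ hd hdp)
    rw [hC, gaussRatio_two_mul_eq, gaussRatio_two_mul_eq]
    field_simp
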